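/- All manifolds and maps are $C^\infty$. An *almost hypercomplex manifold with Hermitian and Norden metrics* $(\overline M,H,G)$ is a $4n$-dimensional manifold with almost complex structures $H=(J_1,J_2,J_3)$ satisfying $J_\alpha^2=-I$ and $J_\alpha=J_\beta J_\gamma=-J_\gamma J_\beta$ for all cyclic permutations $(\alpha,\beta,\gamma)$ of $(1,2,3)$, and with a pseudo-Riemannian metric $g$ satisfying $g(J_1X,J_1Y)=-g(J_2X,J_2Y)=-g(J_3X,J_3Y)=g(X,Y)$; here $G=(g,g_1,g_2,g_3)$ with $g_\alpha(X,Y)=g(J_\alpha X,Y)$. Let $\nabla$ be the Levi-Civita connection of $g$ and put $$F_\alpha(X,Y,Z)=g((\nabla_XJ_\alpha)Y,Z),\qquad \theta_\alpha(Z)=g^{ij}F_\alpha(e_i,e_j,Z)\qquad(\alpha=1,2,3).$$ It is a *$\mathcal K$-manifold* if $\nabla J_\alpha=0$ for $\alpha=1,2,3$. It is a *$\mathcal W$-manifold* if $J_1,J_2,J_3$ are integrable (their Nijenhuis tensors vanish), $$F_1(X,Y,Z)=\tfrac{1}{2(2n-1)}\big[g(X,Y)\theta_1(Z)-g(X,Z)\theta_1(Y)-g(X,J_1Y)\theta_1(J_1Z)+g(X,J_1Z)\theta_1(J_1Y)\big],$$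 and, for $\alpha=2,3$, $$F_\alpha(X,Y,Z)=\tfrac{1}{4n}\big[g(X,Y)\theta_\alpha(Z)+g(X,Z)\theta_\alpha(Y)+g(X,J_\alpha Y)\theta_\alpha(J_\alpha Z)+g(X,J_\alpha Z)\theta_\alpha(J_\alpha Y)\big].$$ A *holomorphic submanifold* of $(\overline M,H,G)$ is an immersed submanifold $M$ of dimension $4m$, $1\le m<n$, such that $J_\alpha(T_pM)=T_pM$ for all $p\in M$ and $\alpha=1,2,3$, and such that the restriction of $g$ to $TM$ is nondegenerate; it is then itself an almost hypercomplex manifold with Hermitian and Norden metrics for the restrictions of $H$ and $G$. Its second fundamental form $h$ is defined by $\overline\nabla_XY=\nabla_XY+h(X,Y)$, where $\overline\nabla,\nabla$ are the Levi-Civita connections of $\overline M$ and $M$, its mean curvature vector is $C=\frac1{4m}\operatorname{trace}h$ (the trace with respect to $g|_{TM}$), and $M$ is *totally umbilical* if $h(X,Y)=g(X,Y)\,C$ for all $X,Y\in TM$. **Corollary 3.3.** Let $M$ be a holomorphic submanifold of a $\mathcal W$-manifold $\overline M$, and suppose that $M$, with the restricted structures, is a $\mathcal K$-manifold. Then $M$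 is totally umbilical. Moreover, $C_p\neq0$ at every point $p\in M$ at which some Lee form $\overline\theta_\alpha$ ($\alpha=1,2,3$) of $\overline M$ is not zero on $T_p\overline M$. -/

import Mathlib

open Bundle
open scoped Manifold ContDiff Topology

noncomputable section

set_option linter.unusedSectionVars false

namespace HN

section Frames

variable {E : Type*} [NormedAddCommGroup E] [NormedSpace ℝ E]
  {M : Type*} [TopologicalSpace M] [ChartedSpace E M] [IsManifold 𝓘(ℝ, E) ∞ M]

/-- The coordinate frame of the preferred chart at `p`, at the nearby point `q`: it sends
a vector of the model space (a list of components) to the tangent vector at `q` with these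
components. -/
def frame (p q : M) : E →L[ℝ] TangentSpace 𝓘(ℝ, E) q :=
  (trivializationAt E (TangentSpace 𝓘(ℝ, E)) p).symmL ℝ q

/-- The components of a tangent vector at `q` in the preferred chart at `p`. -/
def coords (p q : M) : TangentSpace 𝓘(ℝ, E) q →L[ℝ] E :=
  (trivializationAt E (TangentSpace 𝓘(ℝ, E)) p).continuousLinearMapAt ℝ q

/-- At the base point itself, the components of a vector of `T_p M` are that vector
(Mathlib identifies `T_p M` with the model space by means of the preferred chart at `p`). -/
theorem coords_self (p : M) :
    (coords p p : TangentSpace 𝓘(ℝ, E) p →L[ℝ] E) = ContinuousLinearMap.id ℝ E := by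
  unfold coords
  rw [TangentBundle.continuousLinearMapAt_trivializationAt (by simp), mfderiv_extChartAt_self]
  rfl

theorem frame_coords {p q : M} (hq : q ∈ (chartAt E p).source) (u : TangentSpace 𝓘(ℝ, E) q) :
    frame p q (coords p q u) = u :=
  Trivialization.symmL_continuousLinearMapAt _ (by simpa using hq) u

theorem coords_frame {p q : M} (hq : q ∈ (chartAt E p).source) (v : E) :
    coords p q (frame p q v) = v :=
  Trivialization.continuousLinearMapAt_symmL _ (by simpa using hq) v

theorem frame_self (p : M) (v : E) : frame p p v = (v : TangentSpace 𝓘(ℝ, E) p) := by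
  have h := coords_frame (E := E) (mem_chart_source E p) v
  rw [coords_self] at h
  exact h

end Frames

section Metric

variable (E : Type*) [NormedAddCommGroup E] [NormedSpace ℝ E]
  (M : Type*) [TopologicalSpace M] [ChartedSpace E M] [IsManifold 𝓘(ℝ, E) ∞ M]

/-- A smooth pseudo-Riemannian metric: a smooth field of nondegenerate symmetric bilinear forms
on the tangent spaces. -/
structure PseudoMetric where
  /-- the bilinear form on `T_p M` -/
  form : ∀ p : M, TangentSpace 𝓘(ℝ, E) p →L[ℝ] TangentSpace 𝓘(ℝ, E) p →L[ℝ] ℝ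
  symm : ∀ (p : M) (u v : TangentSpace 𝓘(ℝ, E) p), form p u v = form p v u
  nondegenerate : ∀ (p : M) (u : TangentSpace 𝓘(ℝ, E) p), (∀ v, form p u v = 0) → u = 0
  smooth : ContMDiff 𝓘(ℝ, E) (𝓘(ℝ, E).prod 𝓘(ℝ, E →L[ℝ] E →L[ℝ] ℝ)) ∞
    (fun p ↦ TotalSpace.mk' (E →L[ℝ] E →L[ℝ] ℝ)
      (E := fun p : M ↦ TangentSpace 𝓘(ℝ, E) p →L[ℝ] TangentSpace 𝓘(ℝ, E) p →L[ℝ] ℝ)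
      p (form p))

/-- An almost hypercomplex structure `(J₁, J₂, J₃)` (here `J 0`, `J 1`, `J 2`) together with a
pseudo-Riemannian metric `g` which is Hermitian for `J₁` and Norden for `J₂` and `J₃`. The indices
live in `Fin 3`, so `(α, α + 1, α + 2)` runs through the cyclic permutations. The associated
tensors `g(J_α ·, ·)` are determined by these data. -/
structure AlmostHypercomplexHN where
  g : PseudoMetric E M
  J : Fin 3 → ∀ p : M, TangentSpace 𝓘(ℝ, E) p →L[ℝ] TangentSpace 𝓘(ℝ, E) p
  smooth_J : ∀ α, ContMDiff 𝓘(ℝ, E) (𝓘(ℝ, E).prod 𝓘(ℝ, E →L[ℝ] E)) ∞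
    (fun p ↦ TotalSpace.mk' (E →L[ℝ] E)
      (E := fun p : M ↦ TangentSpace 𝓘(ℝ, E) p →L[ℝ] TangentSpace 𝓘(ℝ, E) p) p (J α p))
  J_sq : ∀ α p u, J α p (J α p u) = -u
  J_mul : ∀ α p u, J α p u = J (α + 1) p (J (α + 2) p u)
  J_anticomm : ∀ α p u, J (α + 1) p (J (α + 2) p u) = -J (α + 2) p (J (α + 1) p u)
  hermitian : ∀ p u v, g.form p (J 0 p u) (J 0 p v) = g.form p u v
  norden : ∀ α, α ≠ 0 → ∀ p u v, g.form p (J α p u) (J α p v) = -g.form p u v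

end Metric

section LeviCivita

variable {E : Type*} [NormedAddCommGroup E] [NormedSpace ℝ E] [FiniteDimensional ℝ E]
  {M : Type*} [TopologicalSpace M] [ChartedSpace E M] [IsManifold 𝓘(ℝ, E) ∞ M]

instance instFiniteDimensionalTangentSpace (p : M) :
    FiniteDimensional ℝ (TangentSpace 𝓘(ℝ, E) p) :=
  inferInstanceAs (FiniteDimensional ℝ E)

instance instT2SpaceTangentSpace (p : M) : T2Space (TangentSpace 𝓘(ℝ, E) p) :=
  inferInstanceAs (T2Space E)

namespace PseudoMetric

variable (g : PseudoMetric E M)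

/-- Lowering an index, `u ↦ g(u, ·)`, as a linear isomorphism of `T_p M` with its dual. -/
def flat (p : M) :
    TangentSpace 𝓘(ℝ, E) p ≃ₗ[ℝ] (TangentSpace 𝓘(ℝ, E) p →ₗ[ℝ] ℝ) :=
  LinearEquiv.ofInjectiveOfFinrankEq
    (LinearMap.mk₂ ℝ (fun u v ↦ g.form p u v) (by simp) (by simp) (by simp) (by simp))
    (by
      rw [injective_iff_map_eq_zero]
      intro u hu
      exact g.nondegenerate p u fun v ↦ LinearMap.congr_fun hu v)
    (Subspace.dual_finrank_eq).symm

theorem flat_apply (p : M) (u v : TangentSpace 𝓘(ℝ, E) p) : g.flat p u v = g.form p u v := rfl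

/-- The matrix `(g_ij)` of the metric in the chart at `p`, as a function of the nearby point `q`
with values in the bilinear forms on the model space: `(v, w) ↦ g_q(frame p q v, frame p q w)`,
see `components_apply`. -/
def components (p q : M) : E →L[ℝ] E →L[ℝ] ℝ :=
  ContinuousLinearMap.inCoordinates E (TangentSpace 𝓘(ℝ, E)) (E →L[ℝ] ℝ)
    (fun p : M ↦ TangentSpace 𝓘(ℝ, E) p →L[ℝ] ℝ) p q p q (g.form q)

theorem components_apply {p q : M} (hq : q ∈ (chartAt E p).source) (v w : E) :
    g.components p q v w = g.form q (frame p q v) (frame p q w) := by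
  unfold components
  rw [inCoordinates_apply_eq₂ (E₃ := Bundle.Trivial M ℝ) (by simpa using hq) (by simpa using hq)
    (by simp)]
  simp [frame, Trivialization.symmL_apply _ (show q ∈ (trivializationAt E
    (TangentSpace 𝓘(ℝ, E)) p).baseSet by simpa using hq)]

/-- The derivative at `p` of the components of the metric in the chart at `p`:
`dComponents g p u v w = ∂_u g(v, w)`. -/
def dComponents (p : M) (u v w : TangentSpace 𝓘(ℝ, E) p) : ℝ :=
  mvfderiv 𝓘(ℝ, E) (g.components p) p u (coords p p v) (coords p p w)

/-- The linear form `w ↦ ½ (∂_u g(v, w) + ∂_v g(u, w) - ∂_w g(u, v))`. -/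
def koszul (p : M) (u v : TangentSpace 𝓘(ℝ, E) p) : TangentSpace 𝓘(ℝ, E) p →ₗ[ℝ] ℝ where
  toFun w := (1 / 2 : ℝ) *
    (g.dComponents p u v w + g.dComponents p v u w - g.dComponents p w u v)
  map_add' a b := by
    simp only [dComponents, ContinuousLinearMap.map_add, add_apply]; ring
  map_smul' c a := by
    simp only [dComponents, ContinuousLinearMap.map_smul, smul_apply,
      smul_eq_mul, RingHom.id_apply]; ring

/-- The Christoffel symbols at `p` of the Levi-Civita connection, in the chart at `p`:
`g(Γ(u, v), w) = ½ (∂_u g(v, w) + ∂_v g(u, w) - ∂_w g(u, v))`. -/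
def christoffel (p : M) (u v : TangentSpace 𝓘(ℝ, E) p) : TangentSpace 𝓘(ℝ, E) p :=
  (g.flat p).symm (g.koszul p u v)

/-- The defining property of the Christoffel symbols. -/
theorem form_christoffel (p : M) (u v w : TangentSpace 𝓘(ℝ, E) p) :
    g.form p (g.christoffel p u v) w = (1 / 2 : ℝ) *
      (g.dComponents p u v w + g.dComponents p v u w - g.dComponents p w u v) := by
  rw [← flat_apply, christoffel, LinearEquiv.apply_symm_apply]
  rfl

/-- The Levi-Civita covariant derivative `∇_u V` of a vector field `V` along a map
`f : N → M` in the direction `u ∈ T_x N`: in the chart of `M` at `f x`, it is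
`∂_u V + Γ(df u, V)`. -/
def covDerivAlong {E' : Type*} [NormedAddCommGroup E'] [NormedSpace ℝ E']
    {N : Type*} [TopologicalSpace N] [ChartedSpace E' N]
    (f : N → M) (V : ∀ x : N, TangentSpace 𝓘(ℝ, E) (f x)) (x : N)
    (u : TangentSpace 𝓘(ℝ, E') x) : TangentSpace 𝓘(ℝ, E) (f x) :=
  frame (f x) (f x) (mvfderiv 𝓘(ℝ, E') (fun y ↦ coords (f x) (f y) (V y)) x u) +
    g.christoffel (f x) (mfderiv 𝓘(ℝ, E') 𝓘(ℝ, E) f x u) (V x)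

/-- The Levi-Civita covariant derivative `∇_u Y` of a vector field `Y` on `M`. -/
def covDeriv (Y : ∀ p : M, TangentSpace 𝓘(ℝ, E) p) (p : M) (u : TangentSpace 𝓘(ℝ, E) p) :
    TangentSpace 𝓘(ℝ, E) p :=
  g.covDerivAlong id Y p u

/-- The covariant derivative `(∇_u J) v = ∇_u (J V) - J (∇_u V)` of a field of endomorphisms,
where `V` is the extension of `v ∈ T_p M` with constant components in the chart at `p`. -/
def covDerivEnd (J : ∀ p : M, TangentSpace 𝓘(ℝ, E) p →L[ℝ] TangentSpace 𝓘(ℝ, E) p)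
    (p : M) (u v : TangentSpace 𝓘(ℝ, E) p) : TangentSpace 𝓘(ℝ, E) p :=
  g.covDeriv (fun q ↦ J q (frame p q v)) p u - J p (g.covDeriv (fun q ↦ frame p q v) p u)

/-- The metric trace `g^{ij} B(e_i, e_j)` of a bilinear map `B` on `T_p M`, where `(g^{ij})` is the
inverse of the matrix `(g(e_i, e_j))` of `g` in a basis `(e_i)` of `T_p M`. -/
def trace {V : Type*} [AddCommGroup V] [Module ℝ V] (p : M)
    (B : TangentSpace 𝓘(ℝ, E) p → TangentSpace 𝓘(ℝ, E) p → V) : V :=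
  let e := Module.finBasis ℝ (TangentSpace 𝓘(ℝ, E) p)
  ∑ i, ∑ j, ((Matrix.of fun i j ↦ g.form p (e i) (e j))⁻¹ i j) • B (e i) (e j)

end PseudoMetric

/-- Integrability of an almost complex structure: its Nijenhuis tensor
`N(X, Y) = [JX, JY] - J[JX, Y] - J[X, JY] - [X, Y]` vanishes. -/
def IsIntegrable (J : ∀ p : M, TangentSpace 𝓘(ℝ, E) p →L[ℝ] TangentSpace 𝓘(ℝ, E) p) : Prop :=
  ∀ (p : M) (X Y : ∀ q : M, TangentSpace 𝓘(ℝ, E) q),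
    ContMDiffAt 𝓘(ℝ, E) 𝓘(ℝ, E).tangent ∞ (fun q ↦ (⟨q, X q⟩ : TangentBundle 𝓘(ℝ, E) M)) p →
    ContMDiffAt 𝓘(ℝ, E) 𝓘(ℝ, E).tangent ∞ (fun q ↦ (⟨q, Y q⟩ : TangentBundle 𝓘(ℝ, E) M)) p →
    VectorField.mlieBracket 𝓘(ℝ, E) (fun q ↦ J q (X q)) (fun q ↦ J q (Y q)) p
      - J p (VectorField.mlieBracket 𝓘(ℝ, E) (fun q ↦ J q (X q)) Y p)
      - J p (VectorField.mlieBracket 𝓘(ℝ, E) X (fun q ↦ J q (Y q)) p)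
      - VectorField.mlieBracket 𝓘(ℝ, E) X Y p = 0

namespace AlmostHypercomplexHN

variable (S : AlmostHypercomplexHN E M)

/-- The fundamental tensors `F_α(u, v, w) = g((∇_u J_α) v, w)`. -/
def F (α : Fin 3) (p : M) (u v w : TangentSpace 𝓘(ℝ, E) p) : ℝ :=
  S.g.form p (S.g.covDerivEnd (S.J α) p u v) w

/-- The Lee forms `θ_α(w) = g^{ij} F_α(e_i, e_j, w)`. -/
def lee (α : Fin 3) (p : M) (w : TangentSpace 𝓘(ℝ, E) p) : ℝ :=
  S.g.trace p fun u v ↦ S.F α p u v w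

/-- The class of `4n`-dimensional hypercomplex manifolds with Hermitian and Norden metrics that are
of Gray-Hervella type `𝒲₄` for `J₁` and of type `𝒲₁` (among almost complex manifolds with Norden
metric) for `J₂` and `J₃`. -/
structure IsWManifold (n : ℕ) : Prop where
  dim : Module.finrank ℝ E = 4 * n
  hypercomplex : ∀ α, IsIntegrable (S.J α)
  F_zero : ∀ p u v w,
    S.F 0 p u v w = 1 / (2 * (2 * (n : ℝ) - 1)) *
      (S.g.form p u v * S.lee 0 p w - S.g.form p u w * S.lee 0 p v
        - S.g.form p u (S.J 0 p v) * S.lee 0 p (S.J 0 p w)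
        + S.g.form p u (S.J 0 p w) * S.lee 0 p (S.J 0 p v))
  F_norden : ∀ α, α ≠ 0 → ∀ p u v w,
    S.F α p u v w = 1 / (4 * (n : ℝ)) *
      (S.g.form p u v * S.lee α p w + S.g.form p u w * S.lee α p v
        + S.g.form p u (S.J α p v) * S.lee α p (S.J α p w)
        + S.g.form p u (S.J α p w) * S.lee α p (S.J α p v))

/-- The class of manifolds with `∇ J_α = 0` for `α = 1, 2, 3`. -/
def IsKManifold : Prop :=
  ∀ α p u v, S.g.covDerivEnd (S.J α) p u v = 0

end AlmostHypercomplexHN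

end LeviCivita

section Submanifold

variable {E : Type*} [NormedAddCommGroup E] [NormedSpace ℝ E] [FiniteDimensional ℝ E]
  {M : Type*} [TopologicalSpace M] [ChartedSpace E M] [IsManifold 𝓘(ℝ, E) ∞ M]
  {E' : Type*} [NormedAddCommGroup E'] [NormedSpace ℝ E'] [FiniteDimensional ℝ E']
  {M' : Type*} [TopologicalSpace M'] [ChartedSpace E' M'] [IsManifold 𝓘(ℝ, E') ∞ M']

/-- A nondegenerate submanifold: a smooth immersion `f : M → M'` such that the restriction of the
metric of `M'` to the tangent spaces of `M` is nondegenerate. -/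
structure IsNondegenerateSubmanifold (g' : PseudoMetric E' M') (f : M → M') : Prop where
  smooth : ContMDiff 𝓘(ℝ, E) 𝓘(ℝ, E') ∞ f
  immersion : ∀ p, Function.Injective (mfderiv 𝓘(ℝ, E) 𝓘(ℝ, E') f p)
  nondegenerate : ∀ p u, (∀ v, g'.form (f p) (mfderiv 𝓘(ℝ, E) 𝓘(ℝ, E') f p u)
    (mfderiv 𝓘(ℝ, E) 𝓘(ℝ, E') f p v) = 0) → u = 0

/-- A holomorphic submanifold: nondegenerate, with `J_α(T_p M) = T_p M` for all `p` and `α`. -/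
structure IsHolomorphicSubmanifold (S' : AlmostHypercomplexHN E' M') (f : M → M') : Prop
    extends IsNondegenerateSubmanifold (E := E) S'.g f where
  map_J : ∀ α p, (S'.J α (f p)) '' Set.range (mfderiv 𝓘(ℝ, E) 𝓘(ℝ, E') f p) =
    Set.range (mfderiv 𝓘(ℝ, E) 𝓘(ℝ, E') f p)


/-- The components of the differential `df_q` with respect to the charts at `p` and `f p`. -/
def diffComponents (E : Type*) [NormedAddCommGroup E] [NormedSpace ℝ E]
    {M : Type*} [TopologicalSpace M] [ChartedSpace E M] [IsManifold 𝓘(ℝ, E) ∞ M]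
    (E' : Type*) [NormedAddCommGroup E'] [NormedSpace ℝ E']
    {M' : Type*} [TopologicalSpace M'] [ChartedSpace E' M'] [IsManifold 𝓘(ℝ, E') ∞ M']
    (f : M → M') (p q : M) : E →L[ℝ] E' :=
  (coords (f p) (f q)).comp ((mfderiv 𝓘(ℝ, E) 𝓘(ℝ, E') f q).comp (frame p q))

theorem contMDiffAt_diffComponents {f : M → M'} (hf : ContMDiff 𝓘(ℝ, E) 𝓘(ℝ, E') ∞ f) (p : M) :
    ContMDiffAt 𝓘(ℝ, E) 𝓘(ℝ, E →L[ℝ] E') ∞ (diffComponents E E' f p) p :=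
  (hf p).mfderiv_const (m := ∞) (n := ∞) (by simp)

theorem contMDiffAt_components (g : PseudoMetric E M) (p : M) :
    ContMDiffAt 𝓘(ℝ, E) 𝓘(ℝ, E →L[ℝ] E →L[ℝ] ℝ) ∞ (g.components p) p :=
  ((contMDiffAt_hom_bundle _).1 (g.smooth p)).2

namespace IsNondegenerateSubmanifold

variable {g' : PseudoMetric E' M'} {f : M → M'}

/-- The restriction of the metric of `M'` to the tangent spaces of `M`. -/
def inducedForm (g' : PseudoMetric E' M') (f : M → M') (p : M) :
    TangentSpace 𝓘(ℝ, E) p →L[ℝ] TangentSpace 𝓘(ℝ, E) p →L[ℝ] ℝ :=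
  (ContinuousLinearMap.precomp ℝ (mfderiv 𝓘(ℝ, E) 𝓘(ℝ, E') f p)).comp
    ((g'.form (f p)).comp (mfderiv 𝓘(ℝ, E) 𝓘(ℝ, E') f p))

theorem inducedForm_apply (p : M) (u v : TangentSpace 𝓘(ℝ, E) p) :
    inducedForm g' f p u v = g'.form (f p) (mfderiv 𝓘(ℝ, E) 𝓘(ℝ, E') f p u)
      (mfderiv 𝓘(ℝ, E) 𝓘(ℝ, E') f p v) := rfl

theorem eventually_mem_source {f : M → M'} (hf : ContMDiff 𝓘(ℝ, E) 𝓘(ℝ, E') ∞ f) (p : M) :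
    ∀ᶠ q in 𝓝 p, q ∈ (chartAt E p).source ∧ f q ∈ (chartAt E' (f p)).source :=
  Filter.Eventually.and ((chartAt E p).open_source.mem_nhds (mem_chart_source E p))
    ((hf p).continuousAt.preimage_mem_nhds
      ((chartAt E' (f p)).open_source.mem_nhds (mem_chart_source E' (f p))))

theorem smooth_inducedForm {f : M → M'} (hf : ContMDiff 𝓘(ℝ, E) 𝓘(ℝ, E') ∞ f) :
    ContMDiff 𝓘(ℝ, E) (𝓘(ℝ, E).prod 𝓘(ℝ, E →L[ℝ] E →L[ℝ] ℝ)) ∞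
    (fun p ↦ TotalSpace.mk' (E →L[ℝ] E →L[ℝ] ℝ)
      (E := fun p : M ↦ TangentSpace 𝓘(ℝ, E) p →L[ℝ] TangentSpace 𝓘(ℝ, E) p →L[ℝ] ℝ)
      p (inducedForm g' f p)) := by
  intro p
  refine (contMDiffAt_hom_bundle _).2 ⟨contMDiffAt_id, ?_⟩
  have hD := contMDiffAt_diffComponents hf p
  have hG : ContMDiffAt 𝓘(ℝ, E) 𝓘(ℝ, E' →L[ℝ] E' →L[ℝ] ℝ) ∞
      (fun q ↦ g'.components (f p) (f q)) p := (contMDiffAt_components g' (f p)).comp p (hf p)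
  refine ((hD.clm_precomp (F₃ := ℝ)).clm_comp (hG.clm_comp hD)).congr_of_eventuallyEq ?_
  filter_upwards [eventually_mem_source hf p] with q hq
  ext v w
  rw [inCoordinates_apply_eq₂ (E₃ := Bundle.Trivial M ℝ) (by simpa using hq.1)
    (by simpa using hq.1) (by simp)]
  change _ = g'.components (f p) (f q) (diffComponents E E' f p q v) (diffComponents E E' f p q w)
  rw [g'.components_apply hq.2]
  simp only [diffComponents, ContinuousLinearMap.comp_apply]
  rw [frame_coords hq.2, frame_coords hq.2, ← inducedForm_apply]
  simp [frame, Trivialization.symmL_apply _ (show q ∈ (trivializationAt E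
    (TangentSpace 𝓘(ℝ, E)) p).baseSet by simpa using hq.1)]

/-- The induced metric of a nondegenerate submanifold. -/
def inducedMetric (h : IsNondegenerateSubmanifold (E := E) g' f) : PseudoMetric E M where
  form := inducedForm g' f
  symm p _ _ := g'.symm (f p) _ _
  nondegenerate p u hu := h.nondegenerate p u hu
  smooth := smooth_inducedForm h.smooth

end IsNondegenerateSubmanifold

namespace IsHolomorphicSubmanifold

variable {S' : AlmostHypercomplexHN E' M'} {f : M → M'}

/-- The restriction of `J_α` to `T_p M`: the endomorphism `J` of `T_p M` with
`df (J u) = J_α (df u)`, see `mfderiv_inducedJ`. -/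
def inducedJ (h : IsHolomorphicSubmanifold (E := E) S' f) (α : Fin 3) (p : M) :
    TangentSpace 𝓘(ℝ, E) p →L[ℝ] TangentSpace 𝓘(ℝ, E) p :=
  LinearMap.toContinuousLinearMap <|
    (LinearEquiv.ofInjective (mfderiv 𝓘(ℝ, E) 𝓘(ℝ, E') f p).toLinearMap
      (h.immersion p)).symm.toLinearMap ∘ₗ
    LinearMap.codRestrict _ ((S'.J α (f p)).comp (mfderiv 𝓘(ℝ, E) 𝓘(ℝ, E') f p)).toLinearMap
      (fun u ↦ (h.map_J α p).le ⟨_, ⟨u, rfl⟩, rfl⟩)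

theorem mfderiv_inducedJ (h : IsHolomorphicSubmanifold (E := E) S' f) (α : Fin 3) (p : M)
    (u : TangentSpace 𝓘(ℝ, E) p) :
    mfderiv 𝓘(ℝ, E) 𝓘(ℝ, E') f p (h.inducedJ α p u) =
      S'.J α (f p) (mfderiv 𝓘(ℝ, E) 𝓘(ℝ, E') f p u) := by
  have := LinearEquiv.ofInjective_symm_apply
    (f := (mfderiv 𝓘(ℝ, E) 𝓘(ℝ, E') f p).toLinearMap) (h := h.immersion p)
    (LinearMap.codRestrict _
      ((S'.J α (f p)).comp (mfderiv 𝓘(ℝ, E) 𝓘(ℝ, E') f p)).toLinearMap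
      (fun u ↦ (h.map_J α p).le ⟨_, ⟨u, rfl⟩, rfl⟩) u)
  exact this

/-- The components of a field of endomorphisms in the chart at `p`. -/
def endComponents (E : Type*) [NormedAddCommGroup E] [NormedSpace ℝ E]
    {M : Type*} [TopologicalSpace M] [ChartedSpace E M] [IsManifold 𝓘(ℝ, E) ∞ M]
    (J : ∀ p : M, TangentSpace 𝓘(ℝ, E) p →L[ℝ] TangentSpace 𝓘(ℝ, E) p) (p q : M) : E →L[ℝ] E :=
  (coords p q).comp ((J q).comp (frame p q))

theorem isInvertible_components (g : PseudoMetric E M) (p : M) :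
    (g.components p p).IsInvertible := by
  have hinj : Function.Injective (g.components p p).toLinearMap := by
    rw [injective_iff_map_eq_zero]
    intro u hu
    refine g.nondegenerate p u fun v ↦ ?_
    have := g.components_apply (mem_chart_source E p) u (coords p p v)
    rw [frame_coords (mem_chart_source E p), frame_self] at this
    refine this.symm.trans ?_
    exact congrArg (fun A : E →L[ℝ] ℝ ↦ A (coords p p v)) hu
  have hfr : Module.finrank ℝ E = Module.finrank ℝ (E →L[ℝ] ℝ) := by
    rw [← (LinearMap.toContinuousLinearMap (𝕜 := ℝ) (E := E) (F' := ℝ)).finrank_eq]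
    exact (Subspace.dual_finrank_eq).symm
  exact ⟨(LinearEquiv.ofInjectiveOfFinrankEq _ hinj hfr).toContinuousLinearEquiv, rfl⟩

theorem smooth_inducedJ (h : IsHolomorphicSubmanifold (E := E) S' f) (α : Fin 3) :
    ContMDiff 𝓘(ℝ, E) (𝓘(ℝ, E).prod 𝓘(ℝ, E →L[ℝ] E)) ∞
    (fun p ↦ TotalSpace.mk' (E →L[ℝ] E)
      (E := fun p : M ↦ TangentSpace 𝓘(ℝ, E) p →L[ℝ] TangentSpace 𝓘(ℝ, E) p)
      p (h.inducedJ α p)) := by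
  intro p
  refine (contMDiffAt_hom_bundle _).2 ⟨contMDiffAt_id, ?_⟩
  change ContMDiffAt _ _ _ (endComponents E (h.inducedJ α) p) p
  have hD := contMDiffAt_diffComponents h.smooth p
  have hG : ContMDiffAt 𝓘(ℝ, E) 𝓘(ℝ, E' →L[ℝ] E' →L[ℝ] ℝ) ∞
      (fun q ↦ S'.g.components (f p) (f q)) p :=
    (contMDiffAt_components S'.g (f p)).comp p (h.smooth p)
  have hJ' : ContMDiffAt 𝓘(ℝ, E') 𝓘(ℝ, E' →L[ℝ] E') ∞ (endComponents E' (S'.J α) (f p)) (f p) :=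
    ((contMDiffAt_hom_bundle _).1 (S'.smooth_J α (f p))).2
  have hJ : ContMDiffAt 𝓘(ℝ, E) 𝓘(ℝ, E' →L[ℝ] E') ∞
      (fun q ↦ endComponents E' (S'.J α) (f p) (f q)) p := hJ'.comp p (h.smooth p)
  set g := h.toIsNondegenerateSubmanifold.inducedMetric with hg
  have hinv : ContMDiffAt 𝓘(ℝ, E) 𝓘(ℝ, (E →L[ℝ] ℝ) →L[ℝ] E) ∞
      (fun q ↦ (g.components p q).inverse) p :=
    ((isInvertible_components g p).contDiffAt_map_inverse).comp_contMDiffAt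
      (contMDiffAt_components g p)
  have hev : ∀ᶠ q in 𝓝 p, (g.components p q).IsInvertible := by
    have hc := (contMDiffAt_components g p).continuousAt
    obtain ⟨e, he⟩ := isInvertible_components g p
    have : Set.range ((↑) : (E ≃L[ℝ] (E →L[ℝ] ℝ)) → E →L[ℝ] E →L[ℝ] ℝ) ∈ 𝓝 (g.components p p) := by
      rw [← he]; exact ContinuousLinearEquiv.nhds e
    exact hc.preimage_mem_nhds this
  refine (hinv.clm_comp ((hD.clm_precomp (F₃ := ℝ)).clm_comp
    (hG.clm_comp (hJ.clm_comp hD)))).congr_of_eventuallyEq ?_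
  filter_upwards [IsNondegenerateSubmanifold.eventually_mem_source h.smooth p, hev] with q hq hqi
  obtain ⟨e, he⟩ := hqi
  ext v
  simp only [ContinuousLinearMap.comp_apply, ← he, ContinuousLinearMap.inverse_equiv]
  change _ = e.symm _
  rw [ContinuousLinearEquiv.eq_symm_apply]
  ext w
  have he' : ∀ a b, e a b = g.components p q a b := fun a b ↦ by rw [← he]; rfl
  rw [he', g.components_apply hq.1]
  change _ = S'.g.components (f p) (f q)
    (endComponents E' (S'.J α) (f p) (f q) (diffComponents E E' f p q v))
    (diffComponents E E' f p q w)
  rw [S'.g.components_apply hq.2]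
  simp only [diffComponents, endComponents, ContinuousLinearMap.comp_apply]
  rw [frame_coords hq.2, frame_coords hq.2, frame_coords hq.2, frame_coords hq.1,
    ← mfderiv_inducedJ]
  rfl

/-- The structure of almost hypercomplex manifold with Hermitian and Norden metrics which is
induced on a holomorphic submanifold: the restrictions of the `J_α` and of the metric. -/
def induced (h : IsHolomorphicSubmanifold (E := E) S' f) : AlmostHypercomplexHN E M where
  g := h.toIsNondegenerateSubmanifold.inducedMetric
  J := h.inducedJ
  smooth_J := h.smooth_inducedJ
  J_sq α p u := h.immersion p (by simp only [mfderiv_inducedJ, S'.J_sq, map_neg])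
  J_mul α p u := h.immersion p (by simp only [mfderiv_inducedJ, ← S'.J_mul])
  J_anticomm α p u := h.immersion p (by
    simp only [mfderiv_inducedJ, map_neg, S'.J_anticomm α])
  hermitian p u v := by
    refine Eq.trans ?_ (S'.hermitian (f p) (mfderiv 𝓘(ℝ, E) 𝓘(ℝ, E') f p u)
      (mfderiv 𝓘(ℝ, E) 𝓘(ℝ, E') f p v))
    rw [← h.mfderiv_inducedJ, ← h.mfderiv_inducedJ]
    rfl
  norden α hα p u v := by
    refine Eq.trans ?_ (S'.norden α hα (f p) (mfderiv 𝓘(ℝ, E) 𝓘(ℝ, E') f p u)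
      (mfderiv 𝓘(ℝ, E) 𝓘(ℝ, E') f p v))
    rw [← h.mfderiv_inducedJ, ← h.mfderiv_inducedJ]
    rfl

end IsHolomorphicSubmanifold

namespace IsNondegenerateSubmanifold

variable {g' : PseudoMetric E' M'} {f : M → M'} (h : IsNondegenerateSubmanifold (E := E) g' f)

/-- The second fundamental form of a nondegenerate submanifold, given by the Gauss formula
`h(u, Y) = ∇'_u (df Y) - df (∇_u Y)`, where `∇'` and `∇` are the Levi-Civita connections of `M'`
and of `M` with its induced metric, and `Y` is the extension of `v ∈ T_p M` with constant
components in the chart at `p`; the choice of the extension does not matter, see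
`gauss_formula`. -/
def secondFundamentalForm (p : M) (u v : TangentSpace 𝓘(ℝ, E) p) :
    TangentSpace 𝓘(ℝ, E') (f p) :=
  g'.covDerivAlong f (fun q ↦ mfderiv 𝓘(ℝ, E) 𝓘(ℝ, E') f q (frame p q v)) p u -
    mfderiv 𝓘(ℝ, E) 𝓘(ℝ, E') f p (h.inducedMetric.covDeriv (fun q ↦ frame p q v) p u)

theorem mvfderiv_congr {F₁ : Type*} [NormedAddCommGroup F₁] [NormedSpace ℝ F₁] {y y' : M → F₁}
    {p : M} (hyy' : y =ᶠ[𝓝 p] y') (u : TangentSpace 𝓘(ℝ, E) p) :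
    mvfderiv 𝓘(ℝ, E) y p u = mvfderiv 𝓘(ℝ, E) y' p u :=
  congrArg (fun A : E →L[ℝ] F₁ ↦ A u) hyy'.mfderiv_eq

/-- The product rule for the application of a field of linear maps to a function. -/
theorem mvfderiv_clm_apply {F₁ F₂ : Type*} [NormedAddCommGroup F₁] [NormedSpace ℝ F₁]
    [NormedAddCommGroup F₂] [NormedSpace ℝ F₂] {D : M → F₁ →L[ℝ] F₂} {y : M → F₁} {p : M}
    (hD : MDifferentiableAt 𝓘(ℝ, E) 𝓘(ℝ, F₁ →L[ℝ] F₂) D p)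
    (hy : MDifferentiableAt 𝓘(ℝ, E) 𝓘(ℝ, F₁) y p) (u : TangentSpace 𝓘(ℝ, E) p) :
    mvfderiv 𝓘(ℝ, E) (fun q ↦ D q (y q)) p u =
      D p (mvfderiv 𝓘(ℝ, E) y p u) + mvfderiv 𝓘(ℝ, E) D p u (y p) := by
  have hDy := hD.clm_apply hy
  have hD' := hD.differentiableWithinAt_writtenInExtChartAt
  have hy' := hy.differentiableWithinAt_writtenInExtChartAt
  simp only [modelWithCornersSelf_coe, Set.range_id, differentiableWithinAt_univ] at hD' hy'
  rw [hDy.mvfderiv, hD.mvfderiv, hy.mvfderiv]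
  simp only [modelWithCornersSelf_coe, Set.range_id, fderivWithin_univ]
  have key := fderiv_clm_apply hD' hy'
  have h0 : (extChartAt 𝓘(ℝ, E) p).symm (extChartAt 𝓘(ℝ, E) p p) = p := by simp
  have := congrArg (fun A : E →L[ℝ] F₂ ↦ A u) key
  simp only [writtenInExtChartAt, extChartAt_model_space_eq_id, PartialEquiv.refl_coe,
    Function.comp_def, id] at this ⊢
  refine this.trans ?_
  simp only [h0]
  rfl

/-- The Gauss formula `∇'_u (df Y) = df (∇_u Y) + h(u, Y)` for every vector field `Y` on `M` which
is differentiable at `p`. -/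
theorem gauss_formula (p : M) (u : TangentSpace 𝓘(ℝ, E) p)
    (Y : ∀ q : M, TangentSpace 𝓘(ℝ, E) q)
    (hY : MDifferentiableAt 𝓘(ℝ, E) 𝓘(ℝ, E).tangent
      (fun q ↦ (⟨q, Y q⟩ : TangentBundle 𝓘(ℝ, E) M)) p) :
    g'.covDerivAlong f (fun q ↦ mfderiv 𝓘(ℝ, E) 𝓘(ℝ, E') f q (Y q)) p u =
      mfderiv 𝓘(ℝ, E) 𝓘(ℝ, E') f p (h.inducedMetric.covDeriv Y p u) +
        h.secondFundamentalForm p u (Y p) := by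
  have hD : MDifferentiableAt 𝓘(ℝ, E) 𝓘(ℝ, E →L[ℝ] E') (diffComponents E E' f p) p :=
    (contMDiffAt_diffComponents h.smooth p).mdifferentiableAt (by simp)
  have hsrc : ∀ᶠ q in 𝓝 p, q ∈ (chartAt E p).source :=
    (chartAt E p).open_source.mem_nhds (mem_chart_source E p)
  have hy : MDifferentiableAt 𝓘(ℝ, E) 𝓘(ℝ, E) (fun q ↦ coords p q (Y q)) p := by
    refine ((mdifferentiableAt_section 𝓘(ℝ, E) Y).1 hY).congr_of_eventuallyEq ?_
    filter_upwards [hsrc] with q hq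
    exact Trivialization.continuousLinearMapAt_apply_of_mem (R := ℝ)
      (trivializationAt E (TangentSpace 𝓘(ℝ, E)) p) (by simpa using hq) (Y q)
  have e1 : mvfderiv 𝓘(ℝ, E)
      (fun q ↦ coords (f p) (f q) (mfderiv 𝓘(ℝ, E) 𝓘(ℝ, E') f q (Y q))) p u =
      mvfderiv 𝓘(ℝ, E) (fun q ↦ diffComponents E E' f p q (coords p q (Y q))) p u := by
    refine mvfderiv_congr ?_ u
    filter_upwards [hsrc] with q hq
    simp only [diffComponents, ContinuousLinearMap.comp_apply, frame_coords hq]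
  rw [mvfderiv_clm_apply hD hy] at e1
  set v : E := coords p p (Y p) with hv
  have hvY : frame p p v = Y p := frame_coords (mem_chart_source E p) _
  have hvY' : (Y p : E) = v := by rw [hv, coords_self]; rfl
  have e2 : mvfderiv 𝓘(ℝ, E)
      (fun q ↦ coords (f p) (f q) (mfderiv 𝓘(ℝ, E) 𝓘(ℝ, E') f q (frame p q v))) p u =
      mvfderiv 𝓘(ℝ, E) (diffComponents E E' f p) p u v := by
    have := mvfderiv_clm_apply hD (y := fun _ ↦ v) mdifferentiableAt_const u
    rw [mvfderiv_const] at this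
    refine this.trans ?_
    simp
  have e3 : mvfderiv 𝓘(ℝ, E) (fun q ↦ coords p q (frame p q v)) p u = 0 := by
    rw [mvfderiv_congr (y' := fun _ ↦ v) (by
      filter_upwards [hsrc] with q hq using coords_frame hq v) u, mvfderiv_const]
    rfl
  have e4 : frame (f p) (f p) (diffComponents E E' f p p
      (mvfderiv 𝓘(ℝ, E) (fun q ↦ coords p q (Y q)) p u)) =
      mfderiv 𝓘(ℝ, E) 𝓘(ℝ, E') f p
        (frame p p (mvfderiv 𝓘(ℝ, E) (fun q ↦ coords p q (Y q)) p u)) :=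
    frame_coords (mem_chart_source E' (f p)) _
  have hS : h.secondFundamentalForm p u (Y p) = h.secondFundamentalForm p u v := by
    rw [← hvY']
  rw [hS]
  unfold secondFundamentalForm PseudoMetric.covDeriv PseudoMetric.covDerivAlong
  simp only [id]
  rw [e1, e2, e3, hvY, map_add, map_add, map_add, map_zero, map_zero, e4]
  abel

/-- The mean curvature vector `C = (1 / dim M) tr h`. -/
def meanCurvature (p : M) : TangentSpace 𝓘(ℝ, E') (f p) :=
  (1 / (Module.finrank ℝ E : ℝ)) • h.inducedMetric.trace p (h.secondFundamentalForm p)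

/-- Totally umbilical submanifolds: `h(u, v) = g(u, v) C`. -/
def IsTotallyUmbilical : Prop :=
  ∀ p u v, h.secondFundamentalForm p u v = h.inducedMetric.form p u v • h.meanCurvature p

end IsNondegenerateSubmanifold

end Submanifold

end HN

end

noncomputable section

set_option linter.unusedSectionVars false

namespace HN

/-! ### Pointwise algebra: linear forms and symmetric maps compatible with quaternionic structures.
-/

section LinearAlgebra

variable {V W : Type*} [AddCommGroup V] [Module ℝ V] [AddCommGroup W] [Module ℝ W]

/-! Let `A_α` be the ambient vector dual to the Lee form `θ_α`, and let `∇'` be the ambient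
connection. Since every `J_α` is parallel on `M`, the Gauss formula gives `(∇'_u J_α) v = h(u, J_α
v) - J_α h(u, v)` for tangent `u, v` (`covDerivEnd_mfderiv`). The right side is normal, so `F_α`
vanishes on tangent triples. Through the `𝒲` formula this becomes the vanishing of a product of `g`
with the restriction of `θ_α` to `TM`; because `dim M > 2`, that restriction is zero
(`linearForm_eq_zero_of_product_eq_zero`).

With `θ_α` zero on `TM`, the `𝒲` formula for tangent `u, v` reduces to `(∇'_u J_α) v = c_α (g(u, v)
A_α + g(u, J_α v) J_α A_α)`, where `c_α ≠ 0`. Putting `C_α = c_α J_α A_α`, this says that `h - g ⊗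
C_α` intertwines the two actions of `J_α` in its second argument, hence in its first as well, since
`h` and `g` are symmetric.

The rest is algebra (`eq_smul_of_quaternionic_defect`). Computing `h(J_0 u, J_1 v)` in two orders,
the anticommutation of `J_0` and `J_1` expresses `2 J_2 h(u, v)` through `g`, `C_0` and `C_1`.
Symmetry of `h` then forces `C_0 = C_1`: only the term with `g(J_0 u, v)` is skew, `J_0` being
Hermitian and `J_1` Norden. Hence `h = g ⊗ C_0`, and then `C_0 = C_α` for every `α`. Taking traces,
the mean curvature is `c_α J_α A_α` for each `α` simultaneously, so it is nonzero wherever some Lee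
form is. -/

/-- The operator `a + b j` is injective, as multiplying it by `a - b j` gives the scalar `a² + b²`.
-/
theorem smul_add_smul_eq_zero_of_sq_eq_neg {j : V →ₗ[ℝ] V} (hj : ∀ v, j (j v) = -v)
    {a b : ℝ} {v : V} (h : a • v + b • j v = 0) (ha : a ≠ 0) : v = 0 := by
  have h2 : a • j v - b • v = 0 := by
    have := congrArg j h
    simp only [map_add, map_smul, hj, map_zero] at this
    rw [← this]; module
  have h3 : (a ^ 2 + b ^ 2) • v = 0 := by
    have : (a ^ 2 + b ^ 2) • v = a • (a • v + b • j v) - b • (a • j v - b • v) := by module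
    rw [this, h, h2]; simp
  exact (smul_eq_zero.1 h3).resolve_left (by positivity)

/-- A linear form `θ` vanishes if a symmetrized product of `θ` and a nondegenerate bilinear form,
`g(X, Y) θ(Z) + s g(X, Z) θ(Y) + s g(X, jY) θ(jZ) + g(X, jZ) θ(jY)`, does. -/
theorem linearForm_eq_zero_of_product_eq_zero [FiniteDimensional ℝ V]
    (hV : 2 < Module.finrank ℝ V) (g : V →ₗ[ℝ] V →ₗ[ℝ] ℝ)
    (hg : ∀ v, (∀ x, g x v = 0) → v = 0) (j : V →ₗ[ℝ] V) (hj : ∀ v, j (j v) = -v)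
    (θ : V →ₗ[ℝ] ℝ) (s t : ℝ)
    (h : ∀ x y z, g x y * θ z + s * (g x z * θ y) + t * (g x (j y) * θ (j z))
      + g x (j z) * θ (j y) = 0) : θ = 0 := by
  ext z
  by_contra hz
  -- Two linear conditions leave a nonzero `y` in dimension above 2. For this `y` the hypothesis
  -- says that `θ(z) y + t θ(jz) jy` is orthogonal to everything.
  obtain ⟨y, hy, hy0⟩ : ∃ y ∈ LinearMap.ker (θ.prod (θ ∘ₗ j)), y ≠ 0 := by
    refine Submodule.exists_mem_ne_zero_of_ne_bot fun hbot ↦ ?_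
    have := LinearMap.finrank_le_finrank_of_injective (LinearMap.ker_eq_bot.1 hbot)
    simp at this
    omega
  have hy' : θ y = 0 ∧ θ (j y) = 0 := by simpa using hy
  refine hy0 (smul_add_smul_eq_zero_of_sq_eq_neg hj (a := θ z) (b := t * θ (j z)) ?_ hz)
  refine hg _ fun x ↦ ?_
  have := h x y z
  rw [hy'.1, hy'.2] at this
  simp only [map_add, map_smul, smul_eq_mul]
  linarith

/-- A symmetric map `h` which is quaternionic in the second argument up to multiples of a
nondegenerate bilinear form is a multiple of this form. -/
theorem eq_smul_of_quaternionic_defect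
    (g : V →ₗ[ℝ] V →ₗ[ℝ] ℝ) (hsymm : ∀ x y, g x y = g y x)
    (hne : ∃ x y, g x y ≠ 0)
    (j : Fin 3 → V →ₗ[ℝ] V) (J : Fin 3 → W →ₗ[ℝ] W)
    (hj0 : ∀ v, j 0 (j 0 v) = -v)
    (hJ : ∀ α w, J α (J α w) = -w)
    (hJmul : ∀ α w, J α w = J (α + 1) (J (α + 2) w))
    (hJanti : ∀ α w, J (α + 1) (J (α + 2) w) = -J (α + 2) (J (α + 1) w))
    (herm : ∀ x y, g (j 0 x) (j 0 y) = g x y)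
    (hnord : ∀ x y, g (j 1 x) (j 1 y) = -g x y)
    (hj01 : ∀ v, j 0 (j 1 v) = -j 1 (j 0 v)) (hj1 : ∀ v, j 1 (j 1 v) = -v)
    (h : V → V → W) (h_symm : ∀ x y, h x y = h y x) (C : Fin 3 → W)
    (hC : ∀ α x y, h x (j α y) - J α (h x y) = g x (j α y) • C α - g x y • J α (C α)) :
    ∀ α x y, h x y = g x y • C α := by
  -- Indices are added modulo 3, so the instance `α = 2` concerns the pair `(0, 1)`.
  have m20 : ∀ w, J 0 (J 1 w) = J 2 w := fun w ↦ (hJmul 2 w).symm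
  have m10 : ∀ w, J 1 (J 0 w) = -J 2 w := fun w ↦ by
    have := hJanti 2 w
    simp only [Fin.reduceAdd] at this
    rw [m20] at this
    rw [this, neg_neg]
  have m21 : ∀ w, J 2 (J 1 w) = -J 0 w := fun w ↦ by
    have h1 := hJanti 0 w
    have h2 := hJmul 0 w
    simp only [Fin.reduceAdd] at h1 h2
    rw [h2, h1, neg_neg]
  have m02 : ∀ w, J 2 (J 0 w) = J 1 w := fun w ↦ (hJmul 1 w).symm
  -- The Hermitian `j 0` is skew-adjoint and the Norden `j 1` is self-adjoint.
  have e0 : ∀ x y, g (j 0 x) y = -g x (j 0 y) := fun x y ↦ by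
    have := herm x (j 0 y)
    rw [hj0, map_neg] at this
    linarith
  have e1 : ∀ x y, g (j 1 x) y = g x (j 1 y) := fun x y ↦ by
    have := hnord x (j 1 y)
    rw [hj1, map_neg] at this
    linarith
  have hR : ∀ α x y, h x (j α y) = J α (h x y) + (g x (j α y) • C α - g x y • J α (C α)) :=
    fun α x y ↦ by rw [← hC]; abel
  have hL : ∀ α x y, h (j α x) y = J α (h x y) + (g (j α x) y • C α - g x y • J α (C α)) :=
    fun α x y ↦ by rw [h_symm, hR, h_symm x y, hsymm y, hsymm y]
  -- Expand `h (j 0 x) (j 1 y)` by extracting `j 1` first or `j 0` first; the leading terms `J 1 (J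
  -- 0 h)` and `J 0 (J 1 h)` differ by `2 J 2 h`.
  have key : ∀ x y, (2 : ℝ) • J 2 (h x y) = g x y • J 2 (C 0 + C 1)
      + g (j 0 x) (j 1 y) • (C 1 - C 0) + g (j 0 x) y • J 1 (C 0 - C 1)
      + g x (j 1 y) • J 0 (C 0 - C 1) := by
    intro x y
    have a := hR 1 (j 0 x) y
    have b := hL 0 x (j 1 y)
    rw [hL 0 x y] at a
    rw [hR 1 x y] at b
    rw [a] at b
    simp only [map_add, map_sub, map_smul, m20, m10] at b ⊢
    have b' := sub_eq_zero.2 b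
    rw [← sub_eq_zero, ← neg_eq_zero, ← b']
    module
  -- Exchange the arguments in `key`: the left side and the coefficients `g x y`, `g (j 0 x) (j 1
  -- y)` and `g x (j 1 y)` are symmetric, while `g (j 0 x) y` is skew, so its vector `J 1 (C 0 - C
  -- 1)` must vanish.
  have hD : C 0 - C 1 = 0 := by
    obtain ⟨x, y, hxy⟩ := hne
    have a := key x (j 0 y)
    have b := key (j 0 y) x
    rw [h_symm, b] at a
    have s1 : g (j 0 (j 0 y)) (j 1 x) = g (j 0 x) (j 1 (j 0 y)) := by
      rw [e0 x, hj01, hj0, map_neg, map_neg, map_neg, LinearMap.neg_apply, hsymm, e1]; simp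
    have s2 : g (j 0 y) (j 1 x) = g x (j 1 (j 0 y)) := by rw [hsymm, e1]
    have s3 : g (j 0 x) (j 0 y) = g x y := herm x y
    have s4 : g (j 0 (j 0 y)) x = -g x y := by rw [hj0, map_neg, LinearMap.neg_apply, hsymm]
    rw [s1, s2, s3, s4, hsymm (j 0 y) x] at a
    have a' : (2 * g x y) • J 1 (C 0 - C 1) = 0 := by
      have := sub_eq_zero.2 a
      rw [← neg_eq_zero, ← this]
      module
    have a2 := (smul_eq_zero.1 a').resolve_left (by simpa using hxy)
    have := congrArg (J 1) a2
    rwa [hJ, map_zero, neg_eq_zero] at this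
  have hC1 : C 1 = C 0 := (sub_eq_zero.1 hD).symm
  have h0 : ∀ x y, h x y = g x y • C 0 := by
    intro x y
    have a := key x y
    rw [hC1] at a
    simp only [sub_self, map_zero, smul_zero, add_zero] at a
    have b := congrArg (J 2) a
    simp only [map_smul, map_add, hJ] at b
    have : (2 : ℝ) • (h x y - g x y • C 0) = 0 := by
      have := sub_eq_zero.2 b
      rw [← neg_eq_zero, ← this]; module
    exact sub_eq_zero.1 ((smul_eq_zero.1 this).resolve_left two_ne_zero)
  -- Inserting `h = g ⊗ C 0` into `hC` leaves `(g x (j α y) - g x y J α) (C 0 - C α) = 0`, and this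
  -- operator is injective.
  have hE : ∀ α, C 0 = C α := by
    intro α
    obtain ⟨x, y, hxy⟩ := hne
    have a := hC α x y
    rw [h0, h0] at a
    refine sub_eq_zero.1
      (smul_add_smul_eq_zero_of_sq_eq_neg (hJ α) (a := -g x y) (b := -g x (j α y)) ?_
        (neg_ne_zero.2 hxy))
    have b := congrArg (J α) (sub_eq_zero.2 a)
    simp only [map_sub, map_smul, hJ, map_zero] at b
    rw [← neg_eq_zero, ← b, map_sub]
    module
  intro α x y
  rw [h0, hE α]

end LinearAlgebra

/-! ### The differential of `f` in charts and the symmetry of its derivative. -/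

section Differential

variable {E : Type*} [NormedAddCommGroup E] [NormedSpace ℝ E] [FiniteDimensional ℝ E]
  {M : Type*} [TopologicalSpace M] [ChartedSpace E M] [IsManifold 𝓘(ℝ, E) ∞ M]
  {E' : Type*} [NormedAddCommGroup E'] [NormedSpace ℝ E'] [FiniteDimensional ℝ E']
  {M' : Type*} [TopologicalSpace M'] [ChartedSpace E' M'] [IsManifold 𝓘(ℝ, E') ∞ M']
  {f : M → M'}

/-- Chain rule in the fixed charts at `p` and `f p`. Having it for all `q` near `p`, not only at
`p`, is what allows differentiating once more. -/
theorem diffComponents_eq_fderiv (hf : ContMDiff 𝓘(ℝ, E) 𝓘(ℝ, E') ∞ f) {p q : M}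
    (hq : q ∈ (chartAt E p).source) (hfq : f q ∈ (chartAt E' (f p)).source) :
    diffComponents E E' f p q =
      fderiv ℝ (writtenInExtChartAt 𝓘(ℝ, E) 𝓘(ℝ, E') p f) (extChartAt 𝓘(ℝ, E) p q) := by
  set z := extChartAt 𝓘(ℝ, E) p q with hz
  have hzq : (extChartAt 𝓘(ℝ, E) p).symm z = q :=
    (extChartAt 𝓘(ℝ, E) p).left_inv (by simpa using hq)
  have hzt : z ∈ (extChartAt 𝓘(ℝ, E) p).target :=
    (extChartAt 𝓘(ℝ, E) p).map_source (by simpa using hq)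
  have h1 : MDifferentiableAt 𝓘(ℝ, E) 𝓘(ℝ, E) (extChartAt 𝓘(ℝ, E) p).symm z := by
    have := mdifferentiableWithinAt_extChartAt_symm (I := 𝓘(ℝ, E)) hzt
    simpa [mdifferentiableWithinAt_univ] using this
  have h2 : MDifferentiableAt 𝓘(ℝ, E) 𝓘(ℝ, E') f ((extChartAt 𝓘(ℝ, E) p).symm z) :=
    (hf _).mdifferentiableAt (by simp)
  have h3 : MDifferentiableAt 𝓘(ℝ, E') 𝓘(ℝ, E') (extChartAt 𝓘(ℝ, E') (f p))
      (f ((extChartAt 𝓘(ℝ, E) p).symm z)) := by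
    rw [hzq]
    exact mdifferentiableAt_extChartAt hfq
  rw [← mfderiv_eq_fderiv]
  have h4 := mfderiv_comp z h3 (h2.comp z h1)
  have h5 := mfderiv_comp z h2 h1
  rw [h5] at h4
  refine Eq.trans ?_ h4.symm
  unfold diffComponents coords frame
  rw [TangentBundle.continuousLinearMapAt_trivializationAt hfq,
    TangentBundle.symmL_trivializationAt hq]
  simp only [modelWithCornersSelf_coe, Set.range_id, mfderivWithin_univ]
  rw [← hz, Function.comp_apply, hzq]
  rfl

/-- Schwarz's theorem for the coordinate expression of `f`. -/
theorem mvfderiv_diffComponents_symm (hf : ContMDiff 𝓘(ℝ, E) 𝓘(ℝ, E') ∞ f) (p : M) (u v : E) :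
    mvfderiv 𝓘(ℝ, E) (diffComponents E E' f p) p u v =
      mvfderiv 𝓘(ℝ, E) (diffComponents E E' f p) p v u := by
  have hD : MDifferentiableAt 𝓘(ℝ, E) 𝓘(ℝ, E →L[ℝ] E') (diffComponents E E' f p) p :=
    (contMDiffAt_diffComponents hf p).mdifferentiableAt (by simp)
  set φ := writtenInExtChartAt 𝓘(ℝ, E) 𝓘(ℝ, E') p f
  have hφ : ContDiffAt ℝ ∞ φ (extChartAt 𝓘(ℝ, E) p p) := by
    have := (contMDiffAt_iff.1 (hf p)).2
    simpa [contDiffWithinAt_univ, φ, writtenInExtChartAt] using this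
  have key : mvfderiv 𝓘(ℝ, E) (diffComponents E E' f p) p =
      fderiv ℝ (fderiv ℝ φ) (extChartAt 𝓘(ℝ, E) p p) := by
    rw [hD.mvfderiv]
    simp only [modelWithCornersSelf_coe, Set.range_id, fderivWithin_univ]
    refine Filter.EventuallyEq.fderiv_eq ?_
    have hc : ContinuousAt (extChartAt 𝓘(ℝ, E) p).symm (extChartAt 𝓘(ℝ, E) p p) :=
      continuousAt_extChartAt_symm p
    have hev := hc.eventually (p := fun q ↦ q ∈ (chartAt E p).source ∧
      f q ∈ (chartAt E' (f p)).source)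
      (by rw [extChartAt_to_inv]
          exact IsNondegenerateSubmanifold.eventually_mem_source hf p)
    filter_upwards [hev, extChartAt_target_mem_nhds (I := 𝓘(ℝ, E)) p] with z hz hzt
    simp only [writtenInExtChartAt, extChartAt_model_space_eq_id, PartialEquiv.refl_coe,
      Function.comp_def, id]
    rw [diffComponents_eq_fderiv hf hz.1 hz.2, (extChartAt 𝓘(ℝ, E) p).right_inv hzt]
  rw [key]
  exact hφ.isSymmSndFDerivAt (by simp; exact WithTop.coe_le_coe.2 le_top) u v

theorem diffComponents_self (f : M → M') (p : M) :
    diffComponents E E' f p p = (show E →L[ℝ] E' from mfderiv 𝓘(ℝ, E) 𝓘(ℝ, E') f p) := by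
  ext v
  simp only [diffComponents, ContinuousLinearMap.comp_apply]
  rw [frame_self, coords_self]
  rfl

end Differential

/-! ### Christoffel symbols, and symmetry and normality of the second fundamental form. -/

section Gauss

variable {E : Type*} [NormedAddCommGroup E] [NormedSpace ℝ E] [FiniteDimensional ℝ E]
  {M : Type*} [TopologicalSpace M] [ChartedSpace E M] [IsManifold 𝓘(ℝ, E) ∞ M]
  {E' : Type*} [NormedAddCommGroup E'] [NormedSpace ℝ E'] [FiniteDimensional ℝ E']
  {M' : Type*} [TopologicalSpace M'] [ChartedSpace E' M'] [IsManifold 𝓘(ℝ, E') ∞ M']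
  {f : M → M'}

open IsNondegenerateSubmanifold

/-- Lets a tangent vector be treated as the value at `p` of a field with constant components. -/
theorem exists_frame_eq {p : M} (v : TangentSpace 𝓘(ℝ, E) p) : ∃ v' : E, frame p p v' = v :=
  ⟨coords p p v, frame_coords (mem_chart_source E p) v⟩

theorem mvfderiv_clm_apply_const {F₁ F₂ : Type*} [NormedAddCommGroup F₁] [NormedSpace ℝ F₁]
    [NormedAddCommGroup F₂] [NormedSpace ℝ F₂] {D : M → F₁ →L[ℝ] F₂} {p : M}
    (hD : MDifferentiableAt 𝓘(ℝ, E) 𝓘(ℝ, F₁ →L[ℝ] F₂) D p) (u : TangentSpace 𝓘(ℝ, E) p) (c : F₁) :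
    mvfderiv 𝓘(ℝ, E) (fun q ↦ D q c) p u = mvfderiv 𝓘(ℝ, E) D p u c := by
  rw [mvfderiv_clm_apply hD mdifferentiableAt_const u, mvfderiv_const]
  simp

theorem mvfderiv_clm_apply_const₂ {F₁ F₂ F₃ : Type*} [NormedAddCommGroup F₁] [NormedSpace ℝ F₁]
    [NormedAddCommGroup F₂] [NormedSpace ℝ F₂] [NormedAddCommGroup F₃] [NormedSpace ℝ F₃]
    {D : M → F₁ →L[ℝ] F₂ →L[ℝ] F₃} {p : M}
    (hD : MDifferentiableAt 𝓘(ℝ, E) 𝓘(ℝ, F₁ →L[ℝ] F₂ →L[ℝ] F₃) D p)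
    (u : TangentSpace 𝓘(ℝ, E) p) (c : F₁) (d : F₂) :
    mvfderiv 𝓘(ℝ, E) (fun q ↦ D q c d) p u = mvfderiv 𝓘(ℝ, E) D p u c d := by
  rw [mvfderiv_clm_apply_const (hD.clm_apply mdifferentiableAt_const), mvfderiv_clm_apply_const hD]

/-- The second derivative `∂_u ∂_v f` in the charts at `p` and `f p`. -/
def hessian (f : M → M') (p : M) (u v : TangentSpace 𝓘(ℝ, E) p) : TangentSpace 𝓘(ℝ, E') (f p) :=
  mvfderiv 𝓘(ℝ, E) (diffComponents E E' f p) p u v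

theorem hessian_symm (hf : ContMDiff 𝓘(ℝ, E) 𝓘(ℝ, E') ∞ f) (p : M)
    (u v : TangentSpace 𝓘(ℝ, E) p) : hessian (E' := E') f p u v = hessian f p v u :=
  mvfderiv_diffComponents_symm hf p u v

namespace PseudoMetric

variable (g : PseudoMetric E M)

theorem form_components_self (p : M) (v w : E) : g.components p p v w = g.form p v w := by
  rw [g.components_apply (mem_chart_source E p), frame_self, frame_self]

theorem mdifferentiableAt_components (p : M) :
    MDifferentiableAt 𝓘(ℝ, E) 𝓘(ℝ, E →L[ℝ] E →L[ℝ] ℝ) (g.components p) p :=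
  (contMDiffAt_components g p).mdifferentiableAt (by simp)

theorem dComponents_apply (p : M) (u v w : TangentSpace 𝓘(ℝ, E) p) :
    g.dComponents p u v w =
      (show E →L[ℝ] E →L[ℝ] ℝ from mvfderiv 𝓘(ℝ, E) (g.components p) p u) v w := by
  rw [dComponents, coords_self]
  rfl

theorem dComponents_eq (p : M) (u v w : TangentSpace 𝓘(ℝ, E) p) :
    g.dComponents p u v w =
      mvfderiv 𝓘(ℝ, E) (fun q ↦ g.components p q (v : E) (w : E)) p u :=
  (g.dComponents_apply p u v w).trans
    (mvfderiv_clm_apply_const₂ (g.mdifferentiableAt_components p) u _ _).symm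

theorem dComponents_symm (p : M) (u v w : TangentSpace 𝓘(ℝ, E) p) :
    g.dComponents p u v w = g.dComponents p u w v := by
  rw [dComponents_eq, dComponents_eq]
  refine mvfderiv_congr ?_ u
  filter_upwards [(chartAt E p).open_source.mem_nhds (mem_chart_source E p)] with q hq
  exact (g.components_apply hq _ _).trans ((g.symm _ _ _).trans (g.components_apply hq _ _).symm)

theorem christoffel_symm (p : M) (u v : TangentSpace 𝓘(ℝ, E) p) :
    g.christoffel p u v = g.christoffel p v u := by
  unfold christoffel
  congr 1
  ext w
  change (1 / 2 : ℝ) * _ = (1 / 2 : ℝ) * _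
  rw [g.dComponents_symm p w u v]
  ring

/-- The metric on `T_p M` as a bilinear form. -/
def bilin (p : M) : TangentSpace 𝓘(ℝ, E) p →ₗ[ℝ] TangentSpace 𝓘(ℝ, E) p →ₗ[ℝ] ℝ :=
  LinearMap.mk₂ ℝ (fun u v ↦ g.form p u v) (by simp) (by simp) (by simp) (by simp)

theorem ext_form {p : M} {u v : TangentSpace 𝓘(ℝ, E) p}
    (h : ∀ w, g.form p u w = g.form p v w) : u = v := by
  refine sub_eq_zero.1 (g.nondegenerate p _ fun w ↦ ?_)
  rw [map_sub, sub_apply, h, sub_self]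

/-- The trace of the metric itself is the dimension. -/
theorem trace_form_smul {V : Type*} [AddCommGroup V] [Module ℝ V] (p : M) (c : V) :
    g.trace p (fun u v ↦ g.form p u v • c) = (Module.finrank ℝ E : ℝ) • c := by
  unfold trace
  set e := Module.finBasis ℝ (TangentSpace 𝓘(ℝ, E) p)
  set G := Matrix.of fun i j ↦ g.form p (e i) (e j) with hG
  have hGt : G.transpose = G := by ext i j; exact g.symm p _ _
  have hu : IsUnit G := by
    refine Matrix.mulVec_injective_iff_isUnit.1 ?_
    refine (injective_iff_map_eq_zero G.mulVecLin).2 fun x hx ↦ ?_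
    have hz : ∑ j, x j • e j = 0 := by
      refine g.nondegenerate p _ fun w ↦ ?_
      have h0 : ∀ i, g.form p (∑ j, x j • e j) (e i) = 0 := fun i ↦ by
        rw [g.symm]
        have := congrFun hx i
        simp only [Matrix.mulVecLin_apply, Matrix.mulVec, dotProduct, Pi.zero_apply] at this
        rw [← this, map_sum]
        simp [hG, mul_comm]
      have : (g.form p (∑ j, x j • e j)).toLinearMap = 0 := e.ext h0
      exact LinearMap.congr_fun this w
    exact funext (Fintype.linearIndependent_iff.1 e.linearIndependent x hz)
  have : ∑ i, ∑ j, G⁻¹ i j * g.form p (e i) (e j) = (Module.finrank ℝ E : ℝ) := by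
    -- The entrywise sum pairs `(i, j)` with `(i, j)`, hence the transpose, which symmetry removes.
    have h1 : (G⁻¹ * G.transpose).trace = (Module.finrank ℝ E : ℝ) := by
      rw [hGt, Matrix.nonsing_inv_mul G ((Matrix.isUnit_iff_isUnit_det G).1 hu), Matrix.trace_one,
        Fintype.card_fin]
      rfl
    rw [← h1]
    rfl
  rw [← this]
  simp only [Finset.sum_smul, smul_smul]
  rfl

end PseudoMetric

namespace IsNondegenerateSubmanifold

variable {g' : PseudoMetric E' M'} (h : IsNondegenerateSubmanifold (E := E) g' f)

theorem mdifferentiableAt_diffComponents (hf : ContMDiff 𝓘(ℝ, E) 𝓘(ℝ, E') ∞ f) (p : M) :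
    MDifferentiableAt 𝓘(ℝ, E) 𝓘(ℝ, E →L[ℝ] E') (diffComponents E E' f p) p :=
  (contMDiffAt_diffComponents hf p).mdifferentiableAt (by simp)

theorem mvfderiv_coords_frame (p : M) (u : TangentSpace 𝓘(ℝ, E) p) (v : E) :
    mvfderiv 𝓘(ℝ, E) (fun q ↦ coords p q (frame p q v)) p u = 0 := by
  rw [mvfderiv_congr (y' := fun _ ↦ v) (by
    filter_upwards [(chartAt E p).open_source.mem_nhds (mem_chart_source E p)] with q hq
      using coords_frame hq v) u, mvfderiv_const]
  rfl

theorem covDeriv_frame (g : PseudoMetric E M) (p : M) (u : TangentSpace 𝓘(ℝ, E) p) (v : E) :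
    g.covDeriv (fun q ↦ frame p q v) p u = g.christoffel p u (frame p p v) := by
  have h1 : g.covDeriv (fun q ↦ frame p q v) p u =
      frame p p (mvfderiv 𝓘(ℝ, E) (fun q ↦ coords p q (frame p q v)) p u) +
        g.christoffel p (mfderiv 𝓘(ℝ, E) 𝓘(ℝ, E) id p u) (frame p p v) := rfl
  rw [h1, mvfderiv_coords_frame, map_zero, zero_add, mfderiv_id]
  rfl

theorem covDerivAlong_mfderiv_frame (hf : ContMDiff 𝓘(ℝ, E) 𝓘(ℝ, E') ∞ f) (p : M)
    (u : TangentSpace 𝓘(ℝ, E) p) (v : E) :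
    g'.covDerivAlong f (fun q ↦ mfderiv 𝓘(ℝ, E) 𝓘(ℝ, E') f q (frame p q v)) p u =
      hessian f p u (frame p p v) + g'.christoffel (f p) (mfderiv 𝓘(ℝ, E) 𝓘(ℝ, E') f p u)
        (mfderiv 𝓘(ℝ, E) 𝓘(ℝ, E') f p (frame p p v)) := by
  have h1 : g'.covDerivAlong f (fun q ↦ mfderiv 𝓘(ℝ, E) 𝓘(ℝ, E') f q (frame p q v)) p u =
      frame (f p) (f p) (mvfderiv 𝓘(ℝ, E) (fun q ↦ diffComponents E E' f p q v) p u) +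
        g'.christoffel (f p) (mfderiv 𝓘(ℝ, E) 𝓘(ℝ, E') f p u)
          (mfderiv 𝓘(ℝ, E) 𝓘(ℝ, E') f p (frame p p v)) := rfl
  rw [h1, mvfderiv_clm_apply_const (mdifferentiableAt_diffComponents hf p), frame_self (f p),
    frame_self p]
  rfl

/-- The extension of `v` has constant components, so only `∂∂f` and the two Christoffel terms
remain; each is symmetric in `u, v`. -/
theorem secondFundamentalForm_eq (p : M) (u v : TangentSpace 𝓘(ℝ, E) p) :
    h.secondFundamentalForm p u v = hessian f p u v +
      g'.christoffel (f p) (mfderiv 𝓘(ℝ, E) 𝓘(ℝ, E') f p u) (mfderiv 𝓘(ℝ, E) 𝓘(ℝ, E') f p v) -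
      mfderiv 𝓘(ℝ, E) 𝓘(ℝ, E') f p (h.inducedMetric.christoffel p u v) := by
  obtain ⟨v, rfl⟩ := exists_frame_eq v
  have h1 : h.secondFundamentalForm p u (frame p p v) =
      g'.covDerivAlong f (fun q ↦ mfderiv 𝓘(ℝ, E) 𝓘(ℝ, E') f q (frame p q v)) p u -
      mfderiv 𝓘(ℝ, E) 𝓘(ℝ, E') f p (h.inducedMetric.covDeriv (fun q ↦ frame p q v) p u) :=
    congrArg (h.secondFundamentalForm p u) (frame_self (E := E) p v)
  rw [h1, covDerivAlong_mfderiv_frame h.smooth, covDeriv_frame]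

theorem secondFundamentalForm_symm (p : M) (u v : TangentSpace 𝓘(ℝ, E) p) :
    h.secondFundamentalForm p u v = h.secondFundamentalForm p v u := by
  rw [secondFundamentalForm_eq, secondFundamentalForm_eq, hessian_symm h.smooth,
    g'.christoffel_symm, h.inducedMetric.christoffel_symm]

/-- Product and chain rules applied to `g'(df v, df w)` in charts. -/
theorem dComponents_inducedMetric (p : M) (u v w : TangentSpace 𝓘(ℝ, E) p) :
    h.inducedMetric.dComponents p u v w =
      g'.dComponents (f p) (mfderiv 𝓘(ℝ, E) 𝓘(ℝ, E') f p u) (mfderiv 𝓘(ℝ, E) 𝓘(ℝ, E') f p v)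
        (mfderiv 𝓘(ℝ, E) 𝓘(ℝ, E') f p w) +
      g'.form (f p) (hessian f p u v) (mfderiv 𝓘(ℝ, E) 𝓘(ℝ, E') f p w) +
      g'.form (f p) (mfderiv 𝓘(ℝ, E) 𝓘(ℝ, E') f p v) (hessian f p u w) := by
  have hD := mdifferentiableAt_diffComponents h.smooth p
  have hG' := g'.mdifferentiableAt_components (f p)
  have hf : MDifferentiableAt 𝓘(ℝ, E) 𝓘(ℝ, E') f p := (h.smooth p).mdifferentiableAt (by simp)
  have hGf : MDifferentiableAt 𝓘(ℝ, E) 𝓘(ℝ, E' →L[ℝ] E' →L[ℝ] ℝ)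
      (fun q ↦ g'.components (f p) (f q)) p := hG'.comp p hf
  have hGf' : mvfderiv 𝓘(ℝ, E) (fun q ↦ g'.components (f p) (f q)) p u =
      mvfderiv 𝓘(ℝ, E') (g'.components (f p)) (f p) (mfderiv 𝓘(ℝ, E) 𝓘(ℝ, E') f p u) :=
    mfderiv_comp_apply p hG' hf u
  have hDv : ∀ v : E, MDifferentiableAt 𝓘(ℝ, E) 𝓘(ℝ, E') (fun q ↦ diffComponents E E' f p q v) p :=
    fun v ↦ hD.clm_apply (mdifferentiableAt_const (c := v))
  have key : ∀ v w : E, mvfderiv 𝓘(ℝ, E) (fun q ↦ h.inducedMetric.components p q v w) p u =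
      g'.components (f p) (f p) (diffComponents E E' f p p v)
        (mvfderiv 𝓘(ℝ, E) (diffComponents E E' f p) p u w) +
      (g'.components (f p) (f p) (mvfderiv 𝓘(ℝ, E) (diffComponents E E' f p) p u v)
        (diffComponents E E' f p p w) +
      mvfderiv 𝓘(ℝ, E') (g'.components (f p)) (f p) (mfderiv 𝓘(ℝ, E) 𝓘(ℝ, E') f p u)
        (diffComponents E E' f p p v) (diffComponents E E' f p p w)) := by
    intro v w
    have e : mvfderiv 𝓘(ℝ, E) (fun q ↦ h.inducedMetric.components p q v w) p u =
        mvfderiv 𝓘(ℝ, E) (fun q ↦ g'.components (f p) (f q) (diffComponents E E' f p q v)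
          (diffComponents E E' f p q w)) p u := by
      refine mvfderiv_congr ?_ u
      filter_upwards [eventually_mem_source h.smooth p] with q hq
      rw [h.inducedMetric.components_apply hq.1, g'.components_apply hq.2]
      simp only [diffComponents, ContinuousLinearMap.comp_apply]
      rw [frame_coords hq.2, frame_coords hq.2]
      rfl
    rw [e, mvfderiv_clm_apply (hGf.clm_apply (hDv v)) (hDv w), mvfderiv_clm_apply hGf (hDv v),
      mvfderiv_clm_apply_const hD, mvfderiv_clm_apply_const hD, hGf']
    rfl
  rw [PseudoMetric.dComponents_eq]
  refine (key v w).trans ?_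
  rw [PseudoMetric.form_components_self, PseudoMetric.form_components_self]
  rw [diffComponents_self, PseudoMetric.dComponents_apply]
  exact (by intros; ring : ∀ a b c : ℝ, a + (b + c) = c + b + a) _ _ _

/-- The second fundamental form takes values in the normal spaces. -/
theorem form_secondFundamentalForm (p : M) (u v w : TangentSpace 𝓘(ℝ, E) p) :
    g'.form (f p) (h.secondFundamentalForm p u v) (mfderiv 𝓘(ℝ, E) 𝓘(ℝ, E') f p w) = 0 := by
  have h1 : g'.form (f p) (mfderiv 𝓘(ℝ, E) 𝓘(ℝ, E') f p (h.inducedMetric.christoffel p u v))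
      (mfderiv 𝓘(ℝ, E) 𝓘(ℝ, E') f p w) = _ := h.inducedMetric.form_christoffel p u v w
  rw [secondFundamentalForm_eq, map_sub, map_add, sub_apply,
    add_apply, g'.form_christoffel, h1]
  simp only [dComponents_inducedMetric]
  -- Of the six Hessian terms in the Koszul combination four cancel, and the other two give exactly
  -- `g'(hessian u v, df w)`.
  rw [hessian_symm h.smooth p v u, hessian_symm h.smooth p w u, hessian_symm h.smooth p w v,
    g'.symm (f p) (mfderiv 𝓘(ℝ, E) 𝓘(ℝ, E') f p u) (hessian f p v w),
    g'.symm (f p) (mfderiv 𝓘(ℝ, E) 𝓘(ℝ, E') f p v) (hessian f p u w)]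
  ring

end IsNondegenerateSubmanifold

end Gauss

/-! ### Covariant derivatives of the `J_α`, Lee forms and umbilicity. -/

section Umbilical

variable {E : Type*} [NormedAddCommGroup E] [NormedSpace ℝ E] [FiniteDimensional ℝ E]
  {M : Type*} [TopologicalSpace M] [ChartedSpace E M] [IsManifold 𝓘(ℝ, E) ∞ M]
  {E' : Type*} [NormedAddCommGroup E'] [NormedSpace ℝ E'] [FiniteDimensional ℝ E']
  {M' : Type*} [TopologicalSpace M'] [ChartedSpace E' M'] [IsManifold 𝓘(ℝ, E') ∞ M']
  {f : M → M'}

open IsNondegenerateSubmanifold IsHolomorphicSubmanifold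

namespace AlmostHypercomplexHN

theorem mdifferentiableAt_endComponents (S : AlmostHypercomplexHN E M) (α : Fin 3) (p : M) :
    MDifferentiableAt 𝓘(ℝ, E) 𝓘(ℝ, E →L[ℝ] E) (endComponents E (S.J α) p) p := by
  have : ContMDiffAt 𝓘(ℝ, E) 𝓘(ℝ, E →L[ℝ] E) ∞ (endComponents E (S.J α) p) p :=
    ((contMDiffAt_hom_bundle _).1 (S.smooth_J α p)).2
  exact this.mdifferentiableAt (by simp)

theorem covDerivEnd_frame (S : AlmostHypercomplexHN E M) (α : Fin 3) (p : M)
    (u : TangentSpace 𝓘(ℝ, E) p) (v : E) :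
    S.g.covDerivEnd (S.J α) p u (frame p p v) =
      frame p p (mvfderiv 𝓘(ℝ, E) (endComponents E (S.J α) p) p u v) +
        S.g.christoffel p u (S.J α p (frame p p v)) -
        S.J α p (S.g.christoffel p u (frame p p v)) := by
  have h1 : S.g.covDerivEnd (S.J α) p u (frame p p v) = S.g.covDerivEnd (S.J α) p u v :=
    congrArg (S.g.covDerivEnd (S.J α) p u) (frame_self (E := E) p v)
  have h2 : S.g.covDerivEnd (S.J α) p u v =
      frame p p (mvfderiv 𝓘(ℝ, E) (fun q ↦ endComponents E (S.J α) p q v) p u) +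
        S.g.christoffel p (mfderiv 𝓘(ℝ, E) 𝓘(ℝ, E) id p u) (S.J α p (frame p p v)) -
        S.J α p (S.g.covDeriv (fun q ↦ frame p q v) p u) := rfl
  rw [h1, h2, mvfderiv_clm_apply_const (S.mdifferentiableAt_endComponents α p), covDeriv_frame,
    mfderiv_id]
  rfl

/-- The product rule `∇_u (J V) = (∇_{df u} J) V + J (∇_u V)` for vector fields along a map. -/
theorem covDerivAlong_J (S' : AlmostHypercomplexHN E' M') (α : Fin 3)
    (hf : ContMDiff 𝓘(ℝ, E) 𝓘(ℝ, E') ∞ f) (p : M) (u : TangentSpace 𝓘(ℝ, E) p)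
    (V : ∀ q : M, TangentSpace 𝓘(ℝ, E') (f q))
    (hV : MDifferentiableAt 𝓘(ℝ, E) 𝓘(ℝ, E') (fun q ↦ coords (f p) (f q) (V q)) p) :
    S'.g.covDerivAlong f (fun q ↦ S'.J α (f q) (V q)) p u =
      S'.g.covDerivEnd (S'.J α) (f p) (mfderiv 𝓘(ℝ, E) 𝓘(ℝ, E') f p u) (V p) +
        S'.J α (f p) (S'.g.covDerivAlong f V p u) := by
  have hJ := S'.mdifferentiableAt_endComponents α (f p)
  have hf' : MDifferentiableAt 𝓘(ℝ, E) 𝓘(ℝ, E') f p := (hf p).mdifferentiableAt (by simp)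
  have hJf : MDifferentiableAt 𝓘(ℝ, E) 𝓘(ℝ, E' →L[ℝ] E')
      (fun q ↦ endComponents E' (S'.J α) (f p) (f q)) p := hJ.comp p hf'
  have hJf' : mvfderiv 𝓘(ℝ, E) (fun q ↦ endComponents E' (S'.J α) (f p) (f q)) p u =
      mvfderiv 𝓘(ℝ, E') (endComponents E' (S'.J α) (f p)) (f p)
        (mfderiv 𝓘(ℝ, E) 𝓘(ℝ, E') f p u) :=
    mfderiv_comp_apply p hJ hf' u
  have e : mvfderiv 𝓘(ℝ, E) (fun q ↦ coords (f p) (f q) (S'.J α (f q) (V q))) p u =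
      mvfderiv 𝓘(ℝ, E) (fun q ↦ endComponents E' (S'.J α) (f p) (f q)
        (coords (f p) (f q) (V q))) p u := by
    refine mvfderiv_congr ?_ u
    filter_upwards [eventually_mem_source hf p] with q hq
    simp only [endComponents, ContinuousLinearMap.comp_apply]
    rw [frame_coords hq.2]
  obtain ⟨v, hv⟩ := exists_frame_eq (V p)
  have hv' : coords (f p) (f p) (V p) = v := by
    rw [← hv, coords_frame (mem_chart_source E' (f p))]
  have e2 : ∀ x : E', frame (f p) (f p) (endComponents E' (S'.J α) (f p) (f p) x) =
      S'.J α (f p) (frame (f p) (f p) x) :=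
    fun x ↦ frame_coords (mem_chart_source E' (f p)) _
  unfold PseudoMetric.covDerivAlong
  have e3 : S'.g.covDerivEnd (S'.J α) (f p) (mfderiv 𝓘(ℝ, E) 𝓘(ℝ, E') f p u) (V p) = _ :=
    (congrArg _ hv.symm).trans (S'.covDerivEnd_frame α (f p) _ v)
  rw [e, mvfderiv_clm_apply hJf hV, hJf', hv', e3, hv, map_add, map_add, e2]
  abel

/-- The Lee form `θ_α` as a linear form on `T_p M`. -/
def leeForm (S : AlmostHypercomplexHN E M) (α : Fin 3) (p : M) :
    TangentSpace 𝓘(ℝ, E) p →ₗ[ℝ] ℝ where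
  toFun := S.lee α p
  map_add' a b := by
    simp only [lee, PseudoMetric.trace, F, map_add, smul_add, Finset.sum_add_distrib]
  map_smul' c a := by
    simp only [lee, PseudoMetric.trace, F, map_smul, RingHom.id_apply, Finset.smul_sum]
    exact Finset.sum_congr rfl fun i _ ↦ Finset.sum_congr rfl fun j _ ↦ smul_comm _ _ _

theorem leeForm_apply (S : AlmostHypercomplexHN E M) (α : Fin 3) (p : M)
    (w : TangentSpace 𝓘(ℝ, E) p) : S.leeForm α p w = S.lee α p w := rfl

/-- The vector field dual to the Lee form `θ_α`. -/
def leeVector (S : AlmostHypercomplexHN E M) (α : Fin 3) (p : M) : TangentSpace 𝓘(ℝ, E) p :=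
  (S.g.flat p).symm (S.leeForm α p)

theorem form_leeVector (S : AlmostHypercomplexHN E M) (α : Fin 3) (p : M)
    (w : TangentSpace 𝓘(ℝ, E) p) : S.g.form p (S.leeVector α p) w = S.lee α p w := by
  rw [← PseudoMetric.flat_apply, leeVector, LinearEquiv.apply_symm_apply, leeForm_apply]

/-- The Hermitian (`ε = -1`) and Norden (`ε = 1`) conditions in a uniform notation. -/
theorem form_J_left (S : AlmostHypercomplexHN E M) (α : Fin 3) (p : M)
    (u v : TangentSpace 𝓘(ℝ, E) p) :
    S.g.form p (S.J α p u) v = (if α = 0 then -1 else 1) * S.g.form p u (S.J α p v) := by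
  split_ifs with hα
  · subst hα
    have := S.hermitian p u (S.J 0 p v)
    rw [S.J_sq, map_neg] at this
    linarith
  · have := S.norden α hα p u (S.J α p v)
    rw [S.J_sq, map_neg] at this
    linarith

/-- The Hermitian and Norden formulas differ only by a sign and a nonzero constant, so all three
structures can be handled together. -/
theorem IsWManifold.exists_F_eq {S : AlmostHypercomplexHN E M} {n : ℕ} (hW : S.IsWManifold n)
    (hn : 0 < n) (α : Fin 3) : ∃ c : ℝ, c ≠ 0 ∧ ∀ p u v w, S.F α p u v w =
      c * (S.g.form p u v * S.lee α p w
        + (if α = 0 then -1 else 1) * (S.g.form p u w * S.lee α p v)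
        + (if α = 0 then -1 else 1) * (S.g.form p u (S.J α p v) * S.lee α p (S.J α p w))
        + S.g.form p u (S.J α p w) * S.lee α p (S.J α p v)) := by
  have hn' : (1 : ℝ) ≤ n := by exact_mod_cast hn
  by_cases hα : α = 0
  · subst hα
    refine ⟨1 / (2 * (2 * (n : ℝ) - 1)), one_div_ne_zero (by nlinarith), fun p u v w ↦ ?_⟩
    rw [hW.F_zero]
    simp only [if_true]
    ring
  · refine ⟨1 / (4 * (n : ℝ)), one_div_ne_zero (by positivity), fun p u v w ↦ ?_⟩
    rw [hW.F_norden α hα]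
    simp only [if_neg hα]
    ring

end AlmostHypercomplexHN

namespace IsHolomorphicSubmanifold

variable {S' : AlmostHypercomplexHN E' M'} (h : IsHolomorphicSubmanifold (E := E) S' f)

/-- The covariant derivatives of `J_α` on `M'` and `M` differ by `h(u, J_α v) - J_α h(u, v)`. -/
theorem covDerivEnd_mfderiv (α : Fin 3) (p : M) (u v : TangentSpace 𝓘(ℝ, E) p) :
    S'.g.covDerivEnd (S'.J α) (f p) (mfderiv 𝓘(ℝ, E) 𝓘(ℝ, E') f p u)
        (mfderiv 𝓘(ℝ, E) 𝓘(ℝ, E') f p v) =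
      mfderiv 𝓘(ℝ, E) 𝓘(ℝ, E') f p (h.induced.g.covDerivEnd (h.induced.J α) p u v) +
        (h.secondFundamentalForm p u (h.induced.J α p v) -
          S'.J α (f p) (h.secondFundamentalForm p u v)) := by
  obtain ⟨v, rfl⟩ := exists_frame_eq v
  have hY : MDifferentiableAt 𝓘(ℝ, E) 𝓘(ℝ, E).tangent
      (fun q ↦ (⟨q, h.induced.J α q (frame p q v)⟩ : TangentBundle 𝓘(ℝ, E) M)) p := by
    refine (mdifferentiableAt_section 𝓘(ℝ, E) _).2 ?_
    have hJ := (h.induced.mdifferentiableAt_endComponents α p).clm_apply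
      (mdifferentiableAt_const (c := v))
    refine hJ.congr_of_eventuallyEq ?_
    filter_upwards [(chartAt E p).open_source.mem_nhds (mem_chart_source E p)] with q hq
    exact (Trivialization.continuousLinearMapAt_apply_of_mem (R := ℝ)
      (trivializationAt E (TangentSpace 𝓘(ℝ, E)) p) (by simpa using hq) _).symm
  -- The field `J_α V` need not have constant components, so the Gauss formula for general fields is
  -- needed. The product rule expands the same derivative in a second way.
  have h1 := h.gauss_formula p u _ hY
  have h2 : (fun q ↦ mfderiv 𝓘(ℝ, E) 𝓘(ℝ, E') f q (h.induced.J α q (frame p q v))) =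
      fun q ↦ S'.J α (f q) (mfderiv 𝓘(ℝ, E) 𝓘(ℝ, E') f q (frame p q v)) :=
    funext fun q ↦ h.mfderiv_inducedJ α q _
  rw [h2, S'.covDerivAlong_J α h.smooth p u (fun q ↦ mfderiv 𝓘(ℝ, E) 𝓘(ℝ, E') f q (frame p q v))
    ((mdifferentiableAt_diffComponents h.smooth p).clm_apply mdifferentiableAt_const)] at h1
  have h3 : h.secondFundamentalForm p u (frame p p v) =
      S'.g.covDerivAlong f (fun q ↦ mfderiv 𝓘(ℝ, E) 𝓘(ℝ, E') f q (frame p q v)) p u -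
      mfderiv 𝓘(ℝ, E) 𝓘(ℝ, E') f p (h.induced.g.covDeriv (fun q ↦ frame p q v) p u) :=
    congrArg (h.secondFundamentalForm p u) (frame_self (E := E) p v)
  have h4 : h.induced.g.covDerivEnd (h.induced.J α) p u (frame p p v) =
      h.induced.g.covDeriv (fun q ↦ h.induced.J α q (frame p q v)) p u -
        h.induced.J α p (h.induced.g.covDeriv (fun q ↦ frame p q v) p u) :=
    congrArg (h.induced.g.covDerivEnd (h.induced.J α) p u) (frame_self (E := E) p v)
  have h5 : mfderiv 𝓘(ℝ, E) 𝓘(ℝ, E') f p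
      (h.induced.J α p (h.induced.g.covDeriv (fun q ↦ frame p q v) p u)) = _ :=
    h.mfderiv_inducedJ α p _
  rw [h4, map_sub, h5, h3, map_sub]
  refine (eq_sub_of_add_eq h1).trans ?_
  change mfderiv 𝓘(ℝ, E) 𝓘(ℝ, E') f p (h.induced.g.covDeriv
    (fun q ↦ h.induced.J α q (frame p q v)) p u) + _ - _ = _
  abel

theorem covDerivEnd_mfderiv_of_isKManifold (hK : h.induced.IsKManifold) (α : Fin 3) (p : M)
    (u v : TangentSpace 𝓘(ℝ, E) p) :
    S'.g.covDerivEnd (S'.J α) (f p) (mfderiv 𝓘(ℝ, E) 𝓘(ℝ, E') f p u)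
        (mfderiv 𝓘(ℝ, E) 𝓘(ℝ, E') f p v) =
      h.secondFundamentalForm p u (h.induced.J α p v) -
          S'.J α (f p) (h.secondFundamentalForm p u v) := by
  rw [covDerivEnd_mfderiv, hK, map_zero, zero_add]

/-- Both `h(u, J_α v)` and `J_α h(u, v)` are normal: for the latter, move `J_α` onto the tangent
vector `w`. -/
theorem F_mfderiv_eq_zero (hK : h.induced.IsKManifold) (α : Fin 3) (p : M)
    (u v w : TangentSpace 𝓘(ℝ, E) p) :
    S'.F α (f p) (mfderiv 𝓘(ℝ, E) 𝓘(ℝ, E') f p u) (mfderiv 𝓘(ℝ, E) 𝓘(ℝ, E') f p v)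
      (mfderiv 𝓘(ℝ, E) 𝓘(ℝ, E') f p w) = 0 := by
  rw [AlmostHypercomplexHN.F, h.covDerivEnd_mfderiv_of_isKManifold hK, map_sub, sub_apply,
    S'.form_J_left, ← h.mfderiv_inducedJ, h.form_secondFundamentalForm,
    h.form_secondFundamentalForm]
  simp

/-- The Lee forms of the ambient manifold vanish on the tangent spaces of the submanifold. -/
theorem lee_mfderiv_eq_zero (hK : h.induced.IsKManifold) {n : ℕ}
    (hW : S'.IsWManifold n) (hn : 0 < n) (hE : 2 < Module.finrank ℝ E) (α : Fin 3) (p : M)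
    (w : TangentSpace 𝓘(ℝ, E) p) :
    S'.lee α (f p) (mfderiv 𝓘(ℝ, E) 𝓘(ℝ, E') f p w) = 0 := by
  obtain ⟨c, hc, hF⟩ := hW.exists_F_eq hn α
  have key : S'.leeForm α (f p) ∘ₗ (mfderiv 𝓘(ℝ, E) 𝓘(ℝ, E') f p).toLinearMap = 0 := by
    refine linearForm_eq_zero_of_product_eq_zero 
      (show 2 < Module.finrank ℝ (TangentSpace 𝓘(ℝ, E) p) from hE)
      (h.induced.g.bilin p)
      (fun v hv ↦ h.induced.g.nondegenerate p v fun x ↦ ?_) (h.induced.J α p).toLinearMap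
      (h.induced.J_sq α p) _ (if α = 0 then -1 else 1) (if α = 0 then -1 else 1) fun x y z ↦ ?_
    · rw [h.induced.g.symm]
      exact hv x
    · have h1 := hF (f p) (mfderiv 𝓘(ℝ, E) 𝓘(ℝ, E') f p x) (mfderiv 𝓘(ℝ, E) 𝓘(ℝ, E') f p y)
        (mfderiv 𝓘(ℝ, E) 𝓘(ℝ, E') f p z)
      rw [h.F_mfderiv_eq_zero hK, ← h.mfderiv_inducedJ, ← h.mfderiv_inducedJ] at h1
      exact (mul_eq_zero.1 h1.symm).resolve_left hc
  exact LinearMap.congr_fun key w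

/-- For a `𝒦`-submanifold of a `𝒲`-manifold, `h = g ⊗ c_α J_α A_α` for all `α`, where `A_α` is the
vector field dual to the Lee form `θ_α`. -/
theorem exists_secondFundamentalForm_eq (hK : h.induced.IsKManifold) {n : ℕ}
    (hW : S'.IsWManifold n) (hn : 0 < n) (hE : 2 < Module.finrank ℝ E) :
    ∃ c : Fin 3 → ℝ, (∀ α, c α ≠ 0) ∧ ∀ α p u v,
      h.secondFundamentalForm p u v =
        h.inducedMetric.form p u v • c α • S'.J α (f p) (S'.leeVector α (f p)) := by
  choose c hc hF using hW.exists_F_eq hn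
  refine ⟨c, hc, fun α p ↦ ?_⟩
  have defect : ∀ α u v, h.secondFundamentalForm p u (h.induced.J α p v) -
      S'.J α (f p) (h.secondFundamentalForm p u v) =
      h.induced.g.form p u (h.induced.J α p v) • c α • S'.J α (f p) (S'.leeVector α (f p)) -
      h.induced.g.form p u v • S'.J α (f p) (c α • S'.J α (f p) (S'.leeVector α (f p))) := by
    intro α u v
    -- Here `w` is any ambient vector. The Lee form vanishes on `v` and `J_α v`, and `θ_α(J_α w)`
    -- is, up to the sign of `form_J_left`, the product of `J_α A_α` with `w`.
    refine S'.g.ext_form fun w ↦ ?_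
    have h1 := hF α (f p) (mfderiv 𝓘(ℝ, E) 𝓘(ℝ, E') f p u) (mfderiv 𝓘(ℝ, E) 𝓘(ℝ, E') f p v) w
    rw [AlmostHypercomplexHN.F, h.covDerivEnd_mfderiv_of_isKManifold hK, ← h.mfderiv_inducedJ,
      h.lee_mfderiv_eq_zero hK hW hn hE, h.lee_mfderiv_eq_zero hK hW hn hE] at h1
    rw [h1]
    simp only [map_smul, map_sub, sub_apply, smul_apply, smul_eq_mul, S'.J_sq, map_neg, neg_apply,
      S'.form_J_left, S'.form_leeVector]
    have e1 : S'.g.form (f p) (mfderiv 𝓘(ℝ, E) 𝓘(ℝ, E') f p u) (mfderiv 𝓘(ℝ, E) 𝓘(ℝ, E') f p v) =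
      h.induced.g.form p u v := rfl
    have e2 : S'.g.form (f p) (mfderiv 𝓘(ℝ, E) 𝓘(ℝ, E') f p u)
      (mfderiv 𝓘(ℝ, E) 𝓘(ℝ, E') f p (h.inducedJ α p v)) =
      h.induced.g.form p u (h.induced.J α p v) := rfl
    rw [e1, e2]
    ring
  have hne : ∃ x y, h.induced.g.form p x y ≠ 0 := by
    by_contra! hzero
    have : Subsingleton E := ⟨fun x y ↦
      (h.induced.g.nondegenerate p x (hzero x)).trans (h.induced.g.nondegenerate p y (hzero y)).symm⟩
    rw [Module.finrank_zero_of_subsingleton] at hE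
    omega
  have hj01 := h.induced.J_anticomm 2 p
  exact eq_smul_of_quaternionic_defect (V := TangentSpace 𝓘(ℝ, E) p)
    (h.induced.g.bilin p)
    (h.induced.g.symm p) hne (fun α ↦ (h.induced.J α p).toLinearMap)
    (fun α ↦ (S'.J α (f p)).toLinearMap) (h.induced.J_sq 0 p) (fun α ↦ S'.J_sq α (f p))
    (fun α ↦ S'.J_mul α (f p)) (fun α ↦ S'.J_anticomm α (f p)) (h.induced.hermitian p)
    (h.induced.norden 1 (by decide) p) hj01 (h.induced.J_sq 1 p) (h.secondFundamentalForm p)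
    (h.secondFundamentalForm_symm p)
    (fun α ↦ c α • S'.J α (f p) (S'.leeVector α (f p))) defect α

end IsHolomorphicSubmanifold

theorem IsNondegenerateSubmanifold.meanCurvature_eq_of_eq_smul {g' : PseudoMetric E' M'}
    (h : IsNondegenerateSubmanifold (E := E) g' f) (hE : Module.finrank ℝ E ≠ 0) (p : M)
    (C : TangentSpace 𝓘(ℝ, E') (f p))
    (hC : ∀ u v, h.secondFundamentalForm p u v = h.inducedMetric.form p u v • C) :
    h.meanCurvature p = C := by
  have : h.secondFundamentalForm p = fun u v ↦ h.inducedMetric.form p u v • C :=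
    funext fun u ↦ funext fun v ↦ hC u v
  rw [meanCurvature, this, PseudoMetric.trace_form_smul, smul_smul, one_div,
    inv_mul_cancel₀ (Nat.cast_ne_zero.2 hE), one_smul]

end Umbilical

end HN

end

theorem corollary3p3
    {E : Type*} [NormedAddCommGroup E] [NormedSpace ℝ E] [FiniteDimensional ℝ E]
    {M : Type*} [TopologicalSpace M] [ChartedSpace E M] [IsManifold 𝓘(ℝ, E) ∞ M]
    {E' : Type*} [NormedAddCommGroup E'] [NormedSpace ℝ E'] [FiniteDimensional ℝ E']
    {M' : Type*} [TopologicalSpace M'] [ChartedSpace E' M'] [IsManifold 𝓘(ℝ, E') ∞ M']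
    (m n : ℕ) (hm : 0 < m) (hmn : m < n)
    (hdim : Module.finrank ℝ E = 4 * m)
    (S' : HN.AlmostHypercomplexHN E' M') (hW : S'.IsWManifold n)
    (f : M → M') (h : HN.IsHolomorphicSubmanifold (E := E) S' f)
    (hK : h.induced.IsKManifold) :
    h.toIsNondegenerateSubmanifold.IsTotallyUmbilical ∧
      ∀ p : M, (∃ α w, S'.lee α (f p) w ≠ 0) →
        h.toIsNondegenerateSubmanifold.meanCurvature p ≠ 0 := by
  obtain ⟨c, hc, hC⟩ := h.exists_secondFundamentalForm_eq hK hW (by omega) (by omega)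
  -- One vector has three expressions, so whichever Lee form is nonzero can be used below.
  have hmean : ∀ α p, h.toIsNondegenerateSubmanifold.meanCurvature p =
      c α • S'.J α (f p) (S'.leeVector α (f p)) := fun α p ↦
    h.toIsNondegenerateSubmanifold.meanCurvature_eq_of_eq_smul (by omega) p _ (hC α p)
  refine ⟨fun p u v ↦ by rw [hmean 0, hC 0], ?_⟩
  rintro p ⟨α, w, hw⟩ h0
  rw [hmean α, smul_eq_zero] at h0
  have hA := congrArg (S'.J α (f p)) (h0.resolve_left (hc α))
  rw [S'.J_sq, map_zero, neg_eq_zero] at hA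
  rw [← S'.form_leeVector, hA, map_zero] at hw
  exact hw rfl
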